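/- All spaces are complex Banach spaces, $\mathcal L(X,Y)$ is the set of linear, not necessarily bounded or everywhere defined, operators from $X$ to $Y$, and $\mathcal B(X,Y)$ the set of everywhere defined bounded ones. An operator $A$ with domain $\mathcal D(A)\subset X$ is called invertible if it maps $\mathcal D(A)$ bijectively onto $Y$ with bounded inverse. Sums, products and operator matrices have their natural domains; in particular an operator matrix $[A_{j,i}]$ has domain $\bigoplus_i\bigcap_j\mathcal D(A_{j,i})$. Operator functions $S$ and $T$ with values in $\mathcal L(X,X')$ and $\mathcal L(Y,Y')$ are called equivalent on $\Omega\subset\mathbb C$ if for $\lambda\in\Omega$ there are boundedly invertible $E(\lambda)\in\mathcal B(Y',X')$, $F(\lambda)\in\mathcal B(X,Y)$ with $S(\lambda)=E(\lambda)T(\lambda)F(\lambda)$ and $\mathcal D(S(\lambda))=F(\lambda)^{-1}\mathcal D(T(\lambda))$. **Theorem.** Let $\mathcal P(\lambda)=[P_{j,i}(\lambda)]_{j,i=1}^n$, $P_{j,i}(\lambda)=\sum_{k=0}^{d_{j,i}}\lambda^kP_{j,i}^{(k)}$ with $P_{j,i}^{(k)}\in\mathcal L(\mathcal H_i,\mathcal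 H_j)$, and put $P_{j,i}^{(k)}:=0\in\mathcal B(\mathcal H_i,\mathcal H_j)$ for $k>d_{j,i}$. Assume that $d_i:=d_{i,i}>0$, that $d_{j,i}<d_i$ for $j\ne i$, that every $P_{i,i}^{(d_i)}$ is invertible, and that there are $l_i\in\{0,\dots,d_i\}$ with $P_{j,i}^{(k)}\in\mathcal B(\mathcal H_i,\mathcal H_j)$ for all $i,j$ and all $k\neq l_i$. Set $\widehat P_{j,i}^{(k)}:=(P_{j,j}^{(d_j)})^{-1}P_{j,i}^{(k)}$ for $k<d_i$. For each $i$ with $l_i=d_i$ assume that, for all $j$ and all $k<d_j$, $\widehat P_{i,j}^{(k)}$ is closable with closure in $\mathcal B(\mathcal H_j,\mathcal H_i)$. Let $\Omega:=\mathbb C$ if all $l_i=0$ and $\Omega:=\mathbb C\setminus\{0\}$ otherwise. Let $\mathcal T=[T_{j,i}]$ be the operator matrix in $\bigoplus_{i=1}^n\mathcal H_i^{d_i}$ whose block $T_{j,i}\in\mathcal L(\mathcal H_i^{d_i},\mathcal H_j^{d_j})$ has first row $[-\widehat P_{j,i}^{(d_i-1)},\dots,-\widehat P_{j,i}^{(0)}]$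 and whose other rows are zero if $j\neq i$, and are given by identities $I_{\mathcal H_i}$ on the first subdiagonal (and zeros elsewhere) if $j=i$. Let $\mathcal W(\lambda)=\bigoplus_{i=1}^nW_i(\lambda)$, where $W_i(\lambda)$ acts on $\mathcal H_i^{\max(d_i-1,l_i)}$ and is the direct sum of the identity on $\mathcal H_i^{d_i-l_i-1}$ (absent if $l_i\ge d_i-1$) and of the $l_i\times l_i$ block matrix with $-\lambda$ on the diagonal, $I_{\mathcal H_i}$ on the first subdiagonal and zeros elsewhere. Set $L:=\{i:\ l_i=d_i\}$. Then $\mathcal W(\lambda)$ is invertible for all $\lambda\in\Omega$, and: i) If $L=\emptyset$, then $\mathcal P(\lambda)\oplus\mathcal W(\lambda)$ is equivalent to $\mathcal T-\lambda$ on $\Omega$. ii) If $L\neq\emptyset$, then $\mathcal P_d:=\bigoplus_{i\in L}P_{i,i}^{(d_i)}$, with domain $\bigoplus_{i\in L}\mathcal D(P_{i,i}^{(d_i)})$, is invertible, and $\mathcal P(\lambda)\oplus\mathcal W(\lambda)$ is equivalent to $\mathcal P_d\oplus(\mathcal T-\lambda)$ on $\Omega$. iii) If $L=\emptyset$, then,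 after reordering the spaces of $\mathcal P\oplus\mathcal W$ as $\bigoplus_i(\mathcal H_i\oplus\mathcal H_i^{d_i-1})=\bigoplus_i\mathcal H_i^{d_i}$, the equivalence in i) holds with the following everywhere defined, bounded and boundedly invertible operators $\mathcal E(\lambda)=[E_{j,i}(\lambda)]_{j,i=1}^n$ and $\mathcal F(\lambda)=\mathrm{diag}(F_1(\lambda),\dots,F_n(\lambda))$. Number the rows and columns of each block from $0$. The entry of $E_{j,i}(\lambda)\in\mathcal B(\mathcal H_i^{d_i},\mathcal H_j^{d_j})$ in row $0$ and column $c$ is $$-\sum_{k=0}^{c}\lambda^kP_{i,i}^{(d_i-c+k)}\ (c<d_i-l_i,\ j=i),\qquad -\sum_{k=0}^{c-1}\lambda^kP_{j,i}^{(d_i-c+k)}\ (c<d_i-l_i,\ j\ne i),\qquad \sum_{k=0}^{d_i-c-1}\frac{P_{j,i}^{(k)}}{\lambda^{d_i-c-k}}\ (c\ge d_i-l_i).$$ The rows $r\ge1$ of $E_{j,i}(\lambda)$ are zero for $j\ne i$. For $j=i$ the entry in row $r\geq 1$ and column $c$ is $\lambda^{c-r}I_{\mathcal H_i}$ if $r\le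 c<d_i-l_i$, it is $I_{\mathcal H_i}$ if $r=c\ge d_i-l_i$, and it is $0$ otherwise. The entry of $F_i(\lambda)\in\mathcal B(\mathcal H_i^{d_i})$ in row $r$ and column $c$ is $\lambda^{d_i-1-r}I_{\mathcal H_i}$ if $c=0$, it is $I_{\mathcal H_i}$ if $0<c<d_i-l_i$ and $r=c-1$ or if $c\ge d_i-l_i$ and $r=c$, and it is $0$ otherwise. -/

import Mathlib

namespace OpLin

universe u v

noncomputable section

/-! ### Linear operators that need not be bounded or everywhere defined -/

section Operators

variable {X X' Y Y' : Type*}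
  [NormedAddCommGroup X] [NormedSpace ℂ X] [NormedAddCommGroup X'] [NormedSpace ℂ X']
  [NormedAddCommGroup Y] [NormedSpace ℂ Y] [NormedAddCommGroup Y'] [NormedSpace ℂ Y']

/-- An everywhere defined bounded operator, regarded as a linear operator with full domain. -/
def full (B : X →L[ℂ] Y) : X →ₗ.[ℂ] Y := (B : X →ₗ[ℂ] Y).toPMap ⊤

/-- `A ∈ 𝓑(X, Y)`: the operator `A` is everywhere defined and bounded. -/
def IsBoundedOp (A : X →ₗ.[ℂ] Y) : Prop := ∃ B : X →L[ℂ] Y, A = full B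

/-- The operator `A` is closable and its closure belongs to `𝓑(X, Y)`. -/
def ClosureIsBoundedOp (A : X →ₗ.[ℂ] Y) : Prop := A.IsClosable ∧ IsBoundedOp A.closure

/-- `R` is an everywhere defined bounded two-sided inverse of `A : 𝓓(A) → Y`. -/
def IsBoundedInverse (A : X →ₗ.[ℂ] Y) (R : Y →L[ℂ] X) : Prop :=
  (∀ y : Y, ∃ x : A.domain, (x : X) = R y ∧ A x = y) ∧ ∀ x : A.domain, R (A x) = x

/-- The operator `A` is invertible: it maps its domain bijectively onto `Y`, and its inverse is
bounded. -/
def Invertible (A : X →ₗ.[ℂ] Y) : Prop := ∃ R : Y →L[ℂ] X, IsBoundedInverse A R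

open Classical in
/-- The inverse of an invertible operator (and `0` if the operator is not invertible). -/
def inv (A : X →ₗ.[ℂ] Y) : Y →L[ℂ] X :=
  if h : Invertible A then h.choose else 0

/-- The product `E T F` with bounded, everywhere defined `E` and `F`; its domain is
`{x | F x ∈ 𝓓(T)}`, that is, `F⁻¹ 𝓓(T)`. -/
def sandwich (E : Y' →L[ℂ] X') (T : Y →ₗ.[ℂ] Y') (F : X →L[ℂ] Y) : X →ₗ.[ℂ] X' where
  domain := T.domain.comap (F : X →ₗ[ℂ] Y)
  toFun :=
    { toFun := fun x => E (T ⟨F x, x.2⟩)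
      map_add' := fun x y => by
        rw [← map_add, ← LinearPMap.map_add]
        congr 2
        exact Subtype.ext (map_add F (x : X) (y : X))
      map_smul' := fun c x => by
        rw [RingHom.id_apply, ← map_smul, ← LinearPMap.map_smul]
        congr 2
        exact Subtype.ext (map_smul F c (x : X)) }

/-- The direct sum `A ⊕ B`, with domain `𝓓(A) ⊕ 𝓓(B)`. -/
def opSum (A : X →ₗ.[ℂ] X') (B : Y →ₗ.[ℂ] Y') : (X × Y) →ₗ.[ℂ] (X' × Y') where
  domain := A.domain.prod B.domain
  toFun :=
    { toFun := fun x => (A ⟨x.1.1, x.2.1⟩, B ⟨x.1.2, x.2.2⟩)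
      map_add' := fun x y => by
        rw [Prod.mk_add_mk, ← LinearPMap.map_add, ← LinearPMap.map_add]
        rfl
      map_smul' := fun c x => by
        rw [RingHom.id_apply, Prod.smul_mk, ← LinearPMap.map_smul, ← LinearPMap.map_smul]
        rfl }

/-- Equivalence on `Ω` of two operator functions: there are operator functions `E` and `F` on `Ω`
whose values are bounded and boundedly invertible, with `S(z) = E(z) T(z) F(z)` and
`𝓓(S(z)) = F(z)⁻¹ 𝓓(T(z))` for all `z ∈ Ω` (equality of partially defined maps includes the
equality of the domains). -/
def EquivalentOn (Ω : Set ℂ) (S : ℂ → X →ₗ.[ℂ] X') (T : ℂ → Y →ₗ.[ℂ] Y') : Prop :=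
  ∃ (E : Ω → (Y' ≃L[ℂ] X')) (F : Ω → (X ≃L[ℂ] Y)),
    ∀ z : Ω, S z = sandwich (E z : Y' →L[ℂ] X') (T z) (F z : X →L[ℂ] Y)

/-- The operator `T - z`, with domain `𝓓(T)`. -/
def subScalar (T : X →ₗ.[ℂ] X) (z : ℂ) : X →ₗ.[ℂ] X :=
  T - full (z • ContinuousLinearMap.id ℂ X)

end Operators

/-! ### Operator matrices -/

section Matrices

variable {ι κ : Type*} [Fintype ι] [Fintype κ] {X : ι → Type*} {Y : κ → Type*} {Z : ι → Type*}
  [∀ i, NormedAddCommGroup (X i)] [∀ i, NormedSpace ℂ (X i)]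
  [∀ j, NormedAddCommGroup (Y j)] [∀ j, NormedSpace ℂ (Y j)]
  [∀ i, NormedAddCommGroup (Z i)] [∀ i, NormedSpace ℂ (Z i)]

/-- The operator matrix with entries `A j i` (row `j`, column `i`) on its natural domain: the
`i`-th component lies in the domains of all the entries of the `i`-th column. -/
def opMatrix (A : ∀ (j : κ) (i : ι), X i →ₗ.[ℂ] Y j) : (∀ i, X i) →ₗ.[ℂ] (∀ j, Y j) where
  domain :=
    { carrier := {x | ∀ j i, x i ∈ (A j i).domain}
      add_mem' := fun hx hy j i => (A j i).domain.add_mem (hx j i) (hy j i)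
      zero_mem' := fun j i => (A j i).domain.zero_mem
      smul_mem' := fun c _ hx j i => (A j i).domain.smul_mem c (hx j i) }
  toFun :=
    { toFun := fun x j => ∑ i, A j i ⟨x.1 i, x.2 j i⟩
      map_add' := fun x y => by
        funext j
        rw [Pi.add_apply, ← Finset.sum_add_distrib]
        refine Finset.sum_congr rfl fun i _ => ?_
        rw [← LinearPMap.map_add]
        rfl
      map_smul' := fun c x => by
        funext j
        rw [RingHom.id_apply, Pi.smul_apply, Finset.smul_sum]
        refine Finset.sum_congr rfl fun i _ => ?_
        rw [← LinearPMap.map_smul]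
        rfl }

/-- The block diagonal operator `⨁ i, A i` on its natural domain `⨁ i, 𝓓(A i)`. -/
def opDiag (A : ∀ i, X i →ₗ.[ℂ] Z i) : (∀ i, X i) →ₗ.[ℂ] (∀ i, Z i) where
  domain :=
    { carrier := {x | ∀ i, x i ∈ (A i).domain}
      add_mem' := fun hx hy i => (A i).domain.add_mem (hx i) (hy i)
      zero_mem' := fun i => (A i).domain.zero_mem
      smul_mem' := fun c _ hx i => (A i).domain.smul_mem c (hx i) }
  toFun :=
    { toFun := fun x i => A i ⟨x.1 i, x.2 i⟩
      map_add' := fun x y => by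
        funext i
        rw [Pi.add_apply, ← LinearPMap.map_add]
        rfl
      map_smul' := fun c x => by
        funext i
        rw [RingHom.id_apply, Pi.smul_apply, ← LinearPMap.map_smul]
        rfl }

end Matrices

/-! ### Operator matrix polynomials and their linearization -/

/-- An `n × n` operator matrix polynomial on `⨁ i, H i`: the entry in row `j` and column `i` is
`∑ k ≤ deg j i, z ^ k • coeff j i k`, with possibly unbounded coefficients, and
`coeff j i k = 0` (everywhere defined) for `k > deg j i`. -/
structure OpMatrixPoly {n : ℕ} (H : Fin n → Type u)
    [∀ i, NormedAddCommGroup (H i)] [∀ i, NormedSpace ℂ (H i)] where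
  deg : Fin n → Fin n → ℕ
  coeff : ∀ j i : Fin n, ℕ → (H i →ₗ.[ℂ] H j)
  coeff_eq_zero : ∀ j i k, deg j i < k → coeff j i k = 0

namespace OpMatrixPoly

variable {n : ℕ} {H : Fin n → Type u}
  [∀ i, NormedAddCommGroup (H i)] [∀ i, NormedSpace ℂ (H i)]

/-- The diagonal degree `d i = deg i i`. -/
abbrev d (P : OpMatrixPoly H) (i : Fin n) : ℕ := P.deg i i

/-- The value of the operator matrix polynomial at `z`, on its natural domain. -/
def eval (P : OpMatrixPoly H) (z : ℂ) : (∀ i, H i) →ₗ.[ℂ] (∀ i, H i) :=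
  opMatrix fun j i => ∑ k ∈ Finset.range (P.deg j i + 1), z ^ k • P.coeff j i k

/-- The leading coefficient of the `i`-th diagonal entry. -/
def lead (P : OpMatrixPoly H) (i : Fin n) : H i →ₗ.[ℂ] H i := P.coeff i i (P.d i)

/-- The normalized coefficient: the `k`-th coefficient of the entry `(j, i)`, multiplied from the
left by the inverse of the leading coefficient of the `j`-th diagonal entry. -/
def hat (P : OpMatrixPoly H) (j i : Fin n) (k : ℕ) : H i →ₗ.[ℂ] H j :=
  (inv (P.lead j) : H j →ₗ[ℂ] H j).compPMap (P.coeff j i k)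

/-- The identity of `H i` if `j = i`, and the zero operator from `H i` to `H j` if `j ≠ i`. -/
def delta (j i : Fin n) : H i →L[ℂ] H j :=
  (ContinuousLinearMap.proj j).comp (ContinuousLinearMap.single ℂ H i)

/-- The block `T j i : H i ^ d i → H j ^ d j`. Its first row is
`[-hat j i (d i - 1), …, -hat j i 0]`. The other rows vanish if `j ≠ i`; if `j = i` they hold
identities on the first subdiagonal. -/
def blockT (P : OpMatrixPoly H) (j i : Fin n) :
    (Fin (P.d i) → H i) →ₗ.[ℂ] (Fin (P.d j) → H j) :=
  opMatrix fun (r : Fin (P.d j)) (c : Fin (P.d i)) =>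
    if (r : ℕ) = 0 then -P.hat j i (P.d i - 1 - c)
    else if (r : ℕ) = c + 1 then full (delta j i)
    else 0

/-- The block companion operator `T` on `⨁ i, H i ^ d i`, on its natural domain. -/
def companion (P : OpMatrixPoly H) :
    (∀ i, Fin (P.d i) → H i) →ₗ.[ℂ] (∀ i, Fin (P.d i) → H i) :=
  opMatrix fun j i => P.blockT j i

/-- The space `⨁ i, H i ^ max (d i - 1) (l i)` on which `W` acts. -/
abbrev ExtSpace (P : OpMatrixPoly H) (l : Fin n → ℕ) : Type u :=
  ∀ i, Fin (max (P.d i - 1) (l i)) → H i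

/-- The operator `W i (z)` on `H i ^ max (d i - 1) (l i)`: the direct sum of the identity on
`H i ^ (d i - l i - 1)` (absent if `l i ≥ d i - 1`) and of the `l i × l i` block matrix that has
`-z` on the diagonal and identities on the first subdiagonal. -/
def blockW (P : OpMatrixPoly H) (l : Fin n → ℕ) (z : ℂ) (i : Fin n) :
    (Fin (max (P.d i - 1) (l i)) → H i) →ₗ.[ℂ] (Fin (max (P.d i - 1) (l i)) → H i) :=
  opMatrix fun r c =>
    if r = c then
      if (c : ℕ) < P.d i - l i - 1 then full (ContinuousLinearMap.id ℂ (H i))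
      else full (-z • ContinuousLinearMap.id ℂ (H i))
    else if (r : ℕ) = c + 1 ∧ P.d i - l i - 1 ≤ (c : ℕ) then
      full (ContinuousLinearMap.id ℂ (H i))
    else 0

/-- `W(z) = ⨁ i, W i (z)`. -/
def extW (P : OpMatrixPoly H) (l : Fin n → ℕ) (z : ℂ) : P.ExtSpace l →ₗ.[ℂ] P.ExtSpace l :=
  opDiag fun i => P.blockW l z i

/-- The direct sum of the leading coefficients `lead i` over the indices with `l i = d i`. -/
def leadSum (P : OpMatrixPoly H) (l : Fin n → ℕ) :
    (∀ i : {i : Fin n // l i = P.d i}, H i) →ₗ.[ℂ] (∀ i : {i : Fin n // l i = P.d i}, H i) :=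
  opDiag fun i => P.lead i

/-- The set `Ω`: all of `ℂ` if every `l i` is zero, and `ℂ ∖ {0}` otherwise. -/
def Omega (l : Fin n → ℕ) : Set ℂ := {z | (∀ i, l i = 0) ∨ z ≠ 0}

/-! ### The explicit equivalence operators when `l i < d i` for all `i` -/

/-- The block `E j i (z) : H i ^ d i → H j ^ d j`. The columns `c < d i - l i` form the part
`α`, and the remaining `l i` columns form the part `β`.

* First row, part `α`: for `j = i` the entries are
  `-∑ k ≤ c, z ^ k • coeff i i (d i - c + k)`; for `j ≠ i` they are
  `-∑ k < c, z ^ k • coeff j i (d i - c + k)`.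
* First row, part `β`: the entries are `∑ k < d i - c, coeff j i k / z ^ (d i - c - k)`.
* The other rows vanish for `j ≠ i`. For `j = i` they hold `z ^ (c - r)` for
  `r ≤ c < d i - l i`, and the identity on the last `l i` components. -/
def blockE (P : OpMatrixPoly H) (l : Fin n → ℕ) (z : ℂ) (j i : Fin n) :
    (Fin (P.d i) → H i) →ₗ.[ℂ] (Fin (P.d j) → H j) :=
  opMatrix fun (r : Fin (P.d j)) (c : Fin (P.d i)) =>
    if (r : ℕ) = 0 then
      if (c : ℕ) < P.d i - l i then
        -∑ k ∈ Finset.range (if j = i then (c : ℕ) + 1 else (c : ℕ)),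
          z ^ k • P.coeff j i (P.d i - c + k)
      else
        ∑ k ∈ Finset.range (P.d i - c), (z ^ (P.d i - c - k))⁻¹ • P.coeff j i k
    else if (c : ℕ) < P.d i - l i then
      if (r : ℕ) ≤ c then full (z ^ ((c : ℕ) - r) • delta j i) else 0
    else if (r : ℕ) = c then full (delta j i)
    else 0

/-- The operator matrix `E(z)` with blocks `E j i (z)`. -/
def matE (P : OpMatrixPoly H) (l : Fin n → ℕ) (z : ℂ) :
    (∀ i, Fin (P.d i) → H i) →ₗ.[ℂ] (∀ i, Fin (P.d i) → H i) :=
  opMatrix fun j i => P.blockE l z j i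

/-- The block `F i (z)` on `H i ^ d i`. Its first column is `z ^ (d i - 1), …, z, 1`. The columns
`0 < c < d i - l i` hold the identity in row `c - 1`, and the last `l i` columns hold the identity
on the diagonal. -/
def blockF (P : OpMatrixPoly H) (l : Fin n → ℕ) (z : ℂ) (i : Fin n) :
    (Fin (P.d i) → H i) →ₗ.[ℂ] (Fin (P.d i) → H i) :=
  opMatrix fun (r c : Fin (P.d i)) =>
    if (c : ℕ) = 0 then full (z ^ (P.d i - 1 - r) • ContinuousLinearMap.id ℂ (H i))
    else if (c : ℕ) < P.d i - l i then
      if (r : ℕ) + 1 = c then full (ContinuousLinearMap.id ℂ (H i)) else 0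
    else if r = c then full (ContinuousLinearMap.id ℂ (H i))
    else 0

/-- The block diagonal operator matrix `F(z)` with blocks `F i (z)`. -/
def matF (P : OpMatrixPoly H) (l : Fin n → ℕ) (z : ℂ) :
    (∀ i, Fin (P.d i) → H i) →ₗ.[ℂ] (∀ i, Fin (P.d i) → H i) :=
  opDiag fun i => P.blockF l z i

/-- The reordering of the spaces
`(⨁ i, H i) ⊕ (⨁ i, H i ^ (d i - 1)) ≃ ⨁ i, (H i ⊕ H i ^ (d i - 1)) = ⨁ i, H i ^ d i`
in the case `l i < d i` for all `i` (so that `max (d i - 1) (l i) = d i - 1`). -/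
def regroup (P : OpMatrixPoly H) (l : Fin n → ℕ) (hl : ∀ i, l i < P.d i) :
    ((∀ i, H i) × P.ExtSpace l) ≃L[ℂ] (∀ i, Fin (P.d i) → H i) where
  toFun := fun x i r =>
    if h : (r : ℕ) = 0 then x.1 i else x.2 i ⟨(r : ℕ) - 1, by have := r.2; omega⟩
  invFun := fun u =>
    (fun i => u i ⟨0, by have := hl i; omega⟩,
      fun i s => u i ⟨(s : ℕ) + 1, by have := hl i; have := s.2; omega⟩)
  map_add' := fun x y => by
    funext i r
    by_cases h : (r : ℕ) = 0 <;> simp [h]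
  map_smul' := fun c x => by
    funext i r
    by_cases h : (r : ℕ) = 0 <;> simp [h]
  left_inv := fun x => by
    ext i <;> simp
  right_inv := fun u => by
    funext i r
    by_cases h : (r : ℕ) = 0
    · have hr : r = ⟨0, by have := hl i; omega⟩ := Fin.ext h
      simp only [h, dite_true]
      rw [hr]
    · simp only [h, dite_false]
      congr 1
      exact Fin.ext (by simp; omega)
  continuous_toFun := by
    refine continuous_pi fun i => continuous_pi fun r => ?_
    by_cases h : (r : ℕ) = 0
    · simp only [h, dite_true]
      fun_prop
    · simp only [h, dite_false]
      fun_prop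
  continuous_invFun := by
    refine Continuous.prodMk ?_ ?_
    · fun_prop
    · fun_prop

end OpMatrixPoly

end

end OpLin

/-! Suppose first that `l i < d i` for all `i`. Put `u = F x`. In column `i`, the first row of `E (T
- z) F` is, after summation by parts, a sum over `c` of `(C (d-1-c) - z e_c + e_{c+1}) u_c`, where
`e_c` are the first-row entries of `E`, with `e_0 = -C d` and `e_d = 0`. The column `e_0` also
cancels the inverse leading coefficient in `T`. The entries are the solution of `e_{c+1} = z e_c - C
(d-1-c)`, run upwards from `c = 0` and downwards from `c = d`. The two runs meet at the pivot `c =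
d-l-1`, the only place where the recursion fails; the defect there, multiplied by `z ^ l`, is the
whole polynomial. `F` is built so that `u` at the pivot is `z ^ l x_0`, so exactly `P(z) x_0`
survives. The remaining rows turn the differences `u_{r-1} - z u_r` into `W`.

The coefficient with index `l` never enters `e_c`, so `E` is bounded. In `T` that coefficient acts
only on the pivot component, and this makes the domains agree. Bijectivity of `E` and `F` is
elementary substitution, and the open mapping theorem makes the inverses bounded. These facts are
`firstRow_succ`, `firstRow_pivot`, `rowE_colF` and `exists_explicit_equivalence`.

If some `l i = d i`, the leading coefficients of those rows may be unbounded. Multiplying the rows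
by the inverse leading coefficients gives a polynomial with the same companion operator, to which
the first case applies with `l i` replaced by `0`. The closability hypothesis supplies bounded
extensions of the normalized lower coefficients, and with them `P ⊕ 1` is equivalent to the sum of
the leading coefficients and the normalized polynomial (`opEquiv_extraction`). Both versions of `W`
are invertible, hence interchangeable with identities, and the larger one has precisely the extra
components needed for that summand `1`. -/

namespace OpLin

universe u

noncomputable section

/-! ### Partially defined operators described by a domain and a total function -/

section Representation

variable {X X' Y Y' Z : Type*}
  [NormedAddCommGroup X] [NormedSpace ℂ X] [NormedAddCommGroup X'] [NormedSpace ℂ X']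
  [NormedAddCommGroup Y] [NormedSpace ℂ Y] [NormedAddCommGroup Y'] [NormedSpace ℂ Y']
  [NormedAddCommGroup Z] [NormedSpace ℂ Z]

/-- The operator `A` has domain `{x | S x}` and acts there as the function `f`. -/
structure IsGivenBy (A : X →ₗ.[ℂ] Y) (S : X → Prop) (f : X → Y) : Prop where
  mem_iff : ∀ x, x ∈ A.domain ↔ S x
  apply_eq : ∀ (x : X) (hx : x ∈ A.domain), A ⟨x, hx⟩ = f x

namespace IsGivenBy

theorem eq_of {A B : X →ₗ.[ℂ] Y} {S S' : X → Prop} {f g : X → Y} (hA : IsGivenBy A S f)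
    (hB : IsGivenBy B S' g) (hS : ∀ x, S x ↔ S' x) (hfg : ∀ x, S x → f x = g x) : A = B := by
  refine LinearPMap.ext (Submodule.ext fun x => ?_) fun x hx hx' => ?_
  · rw [hA.mem_iff, hB.mem_iff, hS]
  · rw [hA.apply_eq, hB.apply_eq, hfg x ((hA.mem_iff x).1 hx)]

theorem congr {A : X →ₗ.[ℂ] Y} {S S' : X → Prop} {f g : X → Y} (hA : IsGivenBy A S f)
    (hS : ∀ x, S x ↔ S' x) (hfg : ∀ x, S x → f x = g x) : IsGivenBy A S' g :=
  ⟨fun x => (hA.mem_iff x).trans (hS x), fun x hx =>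
    (hA.apply_eq x hx).trans (hfg x ((hA.mem_iff x).1 hx))⟩

/-- A complement of the domain gives a purely algebraic extension, with no continuity. It lets
identities be computed with total linear maps while domains are compared separately. -/
theorem exists_linear (A : X →ₗ.[ℂ] Y) :
    ∃ f : X →ₗ[ℂ] Y, IsGivenBy A (fun x => x ∈ A.domain) f := by
  obtain ⟨f, hf⟩ := LinearMap.exists_extend A.toFun
  exact ⟨f, fun _ => Iff.rfl, fun x hx => (LinearMap.congr_fun hf ⟨x, hx⟩).symm⟩

theorem full (B : X →L[ℂ] Y) : IsGivenBy (full B) (fun _ => True) B :=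
  ⟨fun _ => ⟨fun _ => trivial, fun _ => Submodule.mem_top⟩, fun _ _ => rfl⟩

theorem zero : IsGivenBy (0 : X →ₗ.[ℂ] Y) (fun _ => True) (fun _ => 0) :=
  ⟨fun _ => ⟨fun _ => trivial, fun _ => Submodule.mem_top⟩, fun _ _ => rfl⟩

theorem neg {A : X →ₗ.[ℂ] Y} {S : X → Prop} {f : X → Y} (hA : IsGivenBy A S f) :
    IsGivenBy (-A) S (fun x => -f x) :=
  ⟨fun x => hA.mem_iff x, fun x hx => congrArg Neg.neg (hA.apply_eq x hx)⟩

theorem smul {A : X →ₗ.[ℂ] Y} {S : X → Prop} {f : X → Y} (hA : IsGivenBy A S f) (c : ℂ) :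
    IsGivenBy (c • A) S (fun x => c • f x) :=
  ⟨fun x => hA.mem_iff x, fun x hx => congrArg (c • ·) (hA.apply_eq x hx)⟩

theorem add {A B : X →ₗ.[ℂ] Y} {S S' : X → Prop} {f g : X → Y} (hA : IsGivenBy A S f)
    (hB : IsGivenBy B S' g) : IsGivenBy (A + B) (fun x => S x ∧ S' x) (fun x => f x + g x) :=
  ⟨fun x => and_congr (hA.mem_iff x) (hB.mem_iff x), fun x hx =>
    congrArg₂ (· + ·) (hA.apply_eq x hx.1) (hB.apply_eq x hx.2)⟩

theorem sub {A B : X →ₗ.[ℂ] Y} {S S' : X → Prop} {f g : X → Y} (hA : IsGivenBy A S f)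
    (hB : IsGivenBy B S' g) : IsGivenBy (A - B) (fun x => S x ∧ S' x) (fun x => f x - g x) :=
  ⟨fun x => and_congr (hA.mem_iff x) (hB.mem_iff x), fun x hx =>
    congrArg₂ (· - ·) (hA.apply_eq x hx.1) (hB.apply_eq x hx.2)⟩

theorem sum {α : Type*} (s : Finset α) {A : α → X →ₗ.[ℂ] Y} {S : α → X → Prop}
    {f : α → X → Y} (hA : ∀ a, IsGivenBy (A a) (S a) (f a)) :
    IsGivenBy (∑ a ∈ s, A a) (fun x => ∀ a ∈ s, S a x) (fun x => ∑ a ∈ s, f a x) := by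
  classical
  induction s using Finset.induction_on with
  | empty => exact zero.congr (by simp) (by simp)
  | insert a s ha ih =>
    rw [Finset.sum_insert ha]
    exact ((hA a).add ih).congr (by simp) fun x _ => by rw [Finset.sum_insert ha]

theorem ite {p : Prop} [Decidable p] {A B : X →ₗ.[ℂ] Y} {S S' : X → Prop} {f g : X → Y}
    (hA : IsGivenBy A S f) (hB : IsGivenBy B S' g) :
    IsGivenBy (if p then A else B) (fun x => if p then S x else S' x)
      (fun x => if p then f x else g x) := by
  split_ifs
  · exact hA
  · exact hB

theorem compPMap {A : X →ₗ.[ℂ] Y} {S : X → Prop} {f : X → Y} (hA : IsGivenBy A S f)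
    (B : Y →ₗ[ℂ] Z) : IsGivenBy (B.compPMap A) S (fun x => B (f x)) :=
  ⟨fun x => hA.mem_iff x, fun x hx => congrArg B (hA.apply_eq x hx)⟩

theorem sandwich {T : Y →ₗ.[ℂ] Y'} {S : Y → Prop} {f : Y → Y'} (hT : IsGivenBy T S f)
    (E : Y' →L[ℂ] X') (F : X →L[ℂ] Y) :
    IsGivenBy (sandwich E T F) (fun x => S (F x)) (fun x => E (f (F x))) :=
  ⟨fun x => hT.mem_iff (F x), fun x hx => congrArg E (hT.apply_eq (F x) hx)⟩

theorem opSum {A : X →ₗ.[ℂ] X'} {B : Y →ₗ.[ℂ] Y'} {S : X → Prop} {S' : Y → Prop}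
    {f : X → X'} {g : Y → Y'} (hA : IsGivenBy A S f) (hB : IsGivenBy B S' g) :
    IsGivenBy (opSum A B) (fun x => S x.1 ∧ S' x.2) (fun x => (f x.1, g x.2)) :=
  ⟨fun x => and_congr (hA.mem_iff x.1) (hB.mem_iff x.2), fun x hx =>
    congrArg₂ Prod.mk (hA.apply_eq x.1 hx.1) (hB.apply_eq x.2 hx.2)⟩

theorem subScalar {T : X →ₗ.[ℂ] X} {S : X → Prop} {f : X → X} (hT : IsGivenBy T S f) (z : ℂ) :
    IsGivenBy (subScalar T z) S (fun x => f x - z • x) :=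
  (hT.sub (full (z • ContinuousLinearMap.id ℂ X))).congr (by simp) (by simp)

section Matrices

variable {ι κ : Type*} [Fintype ι] [Fintype κ] {X : ι → Type*} {Y : κ → Type*} {Z : ι → Type*}
  [∀ i, NormedAddCommGroup (X i)] [∀ i, NormedSpace ℂ (X i)]
  [∀ j, NormedAddCommGroup (Y j)] [∀ j, NormedSpace ℂ (Y j)]
  [∀ i, NormedAddCommGroup (Z i)] [∀ i, NormedSpace ℂ (Z i)]

theorem opMatrix {A : ∀ (j : κ) (i : ι), X i →ₗ.[ℂ] Y j} {S : ∀ (_ : κ) (i : ι), X i → Prop}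
    {f : ∀ (j : κ) (i : ι), X i → Y j} (hA : ∀ j i, IsGivenBy (A j i) (S j i) (f j i)) :
    IsGivenBy (opMatrix A) (fun x => ∀ j i, S j i (x i)) (fun x j => ∑ i, f j i (x i)) :=
  ⟨fun x => forall_congr' fun j => forall_congr' fun i => (hA j i).mem_iff (x i), fun x hx =>
    funext fun j => Finset.sum_congr rfl fun i _ => (hA j i).apply_eq (x i) (hx j i)⟩

theorem opDiag {A : ∀ i, X i →ₗ.[ℂ] Z i} {S : ∀ i, X i → Prop}
    {f : ∀ i, X i → Z i} (hA : ∀ i, IsGivenBy (A i) (S i) (f i)) :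
    IsGivenBy (opDiag A) (fun x => ∀ i, S i (x i)) (fun x i => f i (x i)) :=
  ⟨fun x => forall_congr' fun i => (hA i).mem_iff (x i), fun x hx =>
    funext fun i => (hA i).apply_eq (x i) (hx i)⟩

end Matrices

end IsGivenBy

namespace IsBoundedOp

theorem full (B : X →L[ℂ] Y) : IsBoundedOp (full B) := ⟨B, rfl⟩

theorem zero : IsBoundedOp (0 : X →ₗ.[ℂ] Y) :=
  ⟨0, IsGivenBy.zero.eq_of (IsGivenBy.full 0) (by simp) (by simp)⟩

theorem neg {A : X →ₗ.[ℂ] Y} (hA : IsBoundedOp A) : IsBoundedOp (-A) := by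
  obtain ⟨B, rfl⟩ := hA
  exact ⟨-B, (IsGivenBy.full B).neg.eq_of (IsGivenBy.full _) (by simp) (by simp)⟩

theorem smul {A : X →ₗ.[ℂ] Y} (hA : IsBoundedOp A) (c : ℂ) : IsBoundedOp (c • A) := by
  obtain ⟨B, rfl⟩ := hA
  exact ⟨c • B, ((IsGivenBy.full B).smul c).eq_of (IsGivenBy.full _) (by simp) (by simp)⟩

theorem add {A B : X →ₗ.[ℂ] Y} (hA : IsBoundedOp A) (hB : IsBoundedOp B) :
    IsBoundedOp (A + B) := by
  obtain ⟨A, rfl⟩ := hA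
  obtain ⟨B, rfl⟩ := hB
  exact ⟨A + B, ((IsGivenBy.full A).add (IsGivenBy.full B)).eq_of (IsGivenBy.full _)
    (by simp) (by simp)⟩

theorem sum {α : Type*} (s : Finset α) {A : α → X →ₗ.[ℂ] Y} (hA : ∀ a ∈ s, IsBoundedOp (A a)) :
    IsBoundedOp (∑ a ∈ s, A a) := by
  classical
  induction s using Finset.induction_on with
  | empty => exact zero
  | insert a s ha ih =>
    rw [Finset.sum_insert ha]
    exact (hA a (Finset.mem_insert_self a s)).add
      (ih fun b hb => hA b (Finset.mem_insert_of_mem hb))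

theorem compPMap {A : X →ₗ.[ℂ] Y} (hA : IsBoundedOp A) (B : Y →L[ℂ] Z) :
    IsBoundedOp ((B : Y →ₗ[ℂ] Z).compPMap A) := by
  obtain ⟨A, rfl⟩ := hA
  exact ⟨B.comp A, ((IsGivenBy.full A).compPMap _).eq_of (IsGivenBy.full _) (by simp) (by simp)⟩

theorem exists_clm {A : X →ₗ.[ℂ] Y} (hA : IsBoundedOp A) {S : X → Prop} {f : X → Y}
    (h : IsGivenBy A S f) : ∃ B : X →L[ℂ] Y, A = OpLin.full B ∧ ∀ x, B x = f x := by
  obtain ⟨B, rfl⟩ := hA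
  exact ⟨B, rfl, fun x => h.apply_eq x Submodule.mem_top⟩

theorem mem_domain {A : X →ₗ.[ℂ] Y} (hA : IsBoundedOp A) (x : X) : x ∈ A.domain := by
  obtain ⟨B, rfl⟩ := hA
  exact Submodule.mem_top

section Matrices

variable {ι κ : Type*} [Fintype ι] [Fintype κ] {X : ι → Type*} {Y : κ → Type*} {Z : ι → Type*}
  [∀ i, NormedAddCommGroup (X i)] [∀ i, NormedSpace ℂ (X i)]
  [∀ j, NormedAddCommGroup (Y j)] [∀ j, NormedSpace ℂ (Y j)]
  [∀ i, NormedAddCommGroup (Z i)] [∀ i, NormedSpace ℂ (Z i)]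

theorem opMatrix {A : ∀ (j : κ) (i : ι), X i →ₗ.[ℂ] Y j} (hA : ∀ j i, IsBoundedOp (A j i)) :
    IsBoundedOp (opMatrix A) := by
  choose B hB using hA
  refine ⟨ContinuousLinearMap.pi fun j => ∑ i, (B j i).comp (ContinuousLinearMap.proj i), ?_⟩
  obtain rfl : A = fun j i => OpLin.full (B j i) := funext fun j => funext fun i => hB j i
  refine (IsGivenBy.opMatrix fun j i => IsGivenBy.full (B j i)).eq_of (IsGivenBy.full _)
    (by simp) fun x _ => funext fun j => ?_
  simp

theorem opDiag {A : ∀ i, X i →ₗ.[ℂ] Z i} (hA : ∀ i, IsBoundedOp (A i)) :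
    IsBoundedOp (opDiag A) := by
  choose B hB using hA
  refine ⟨ContinuousLinearMap.pi fun i => (B i).comp (ContinuousLinearMap.proj i), ?_⟩
  obtain rfl : A = fun i => OpLin.full (B i) := funext hB
  exact (IsGivenBy.opDiag fun i => IsGivenBy.full (B i)).eq_of (IsGivenBy.full _)
    (by simp) fun x _ => funext fun j => by simp

end Matrices

end IsBoundedOp

/-- A bijective bounded operator between Banach spaces is the restriction of an isomorphism. -/
theorem IsBoundedOp.exists_equiv [CompleteSpace X] [CompleteSpace Y] {A : X →ₗ.[ℂ] Y}
    (hA : IsBoundedOp A) {S : X → Prop} {f : X → Y} (h : IsGivenBy A S f)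
    (hf : Function.Bijective f) :
    ∃ E : X ≃L[ℂ] Y, A = OpLin.full (E : X →L[ℂ] Y) ∧ ∀ x, E x = f x := by
  obtain ⟨B, hB, hBf⟩ := hA.exists_clm h
  obtain rfl : ⇑B = f := funext hBf
  refine ⟨ContinuousLinearEquiv.ofBijective B (LinearMap.ker_eq_bot.2 hf.1)
    (LinearMap.range_eq_top.2 hf.2), ?_, fun _ => rfl⟩
  rw [ContinuousLinearEquiv.coe_ofBijective]
  exact hB

theorem isBoundedInverse_full (E : X ≃L[ℂ] Y) :
    IsBoundedInverse (full (E : X →L[ℂ] Y)) (E.symm : Y →L[ℂ] X) :=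
  ⟨fun y => ⟨⟨E.symm y, Submodule.mem_top⟩, rfl, E.apply_symm_apply y⟩,
    fun x => E.symm_apply_apply x⟩

theorem isBoundedInverse_inv {A : X →ₗ.[ℂ] Y} (hA : Invertible A) :
    IsBoundedInverse A (inv A) := by
  rw [inv, dif_pos hA]
  exact hA.choose_spec

theorem IsGivenBy.apply_inv {A : X →ₗ.[ℂ] Y} {S : X → Prop} {f : X → Y} (hA : IsGivenBy A S f)
    (hi : Invertible A) (y : Y) : S (inv A y) ∧ f (inv A y) = y := by
  obtain ⟨x, hx, hxy⟩ := (isBoundedInverse_inv hi).1 y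
  rw [← hx]
  exact ⟨(hA.mem_iff _).1 x.2, (hA.apply_eq _ x.2).symm.trans hxy⟩

theorem IsGivenBy.inv_apply {A : X →ₗ.[ℂ] Y} {S : X → Prop} {f : X → Y} (hA : IsGivenBy A S f)
    (hi : Invertible A) {x : X} (hx : S x) : inv A (f x) = x := by
  have h := (isBoundedInverse_inv hi).2 ⟨x, (hA.mem_iff x).2 hx⟩
  rwa [hA.apply_eq] at h

theorem invertible_opDiag {ι : Type*} [Fintype ι] {X Z : ι → Type*}
    [∀ i, NormedAddCommGroup (X i)] [∀ i, NormedSpace ℂ (X i)]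
    [∀ i, NormedAddCommGroup (Z i)] [∀ i, NormedSpace ℂ (Z i)]
    {A : ∀ i, X i →ₗ.[ℂ] Z i} (hA : ∀ i, Invertible (A i)) : Invertible (opDiag A) := by
  choose R hR using hA
  refine ⟨ContinuousLinearMap.pi fun i => (R i).comp (ContinuousLinearMap.proj i),
    fun y => ?_, fun x => funext fun i => (hR i).2 ⟨x.1 i, x.2 i⟩⟩
  choose x hx hxy using fun i => (hR i).1 (y i)
  exact ⟨⟨fun i => x i, fun i => (x i).2⟩, funext hx, funext hxy⟩

end Representation

/-! ### Equivalence of single operators -/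

section Similarity

variable {X X' Y Y' Z Z' : Type*}
  [NormedAddCommGroup X] [NormedSpace ℂ X] [NormedAddCommGroup X'] [NormedSpace ℂ X']
  [NormedAddCommGroup Y] [NormedSpace ℂ Y] [NormedAddCommGroup Y'] [NormedSpace ℂ Y']
  [NormedAddCommGroup Z] [NormedSpace ℂ Z] [NormedAddCommGroup Z'] [NormedSpace ℂ Z']

/-- Equivalence of two operators. -/
def OpEquiv (A : X →ₗ.[ℂ] X') (B : Y →ₗ.[ℂ] Y') : Prop :=
  ∃ (E : Y' ≃L[ℂ] X') (F : X ≃L[ℂ] Y), A = sandwich (E : Y' →L[ℂ] X') B (F : X →L[ℂ] Y)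

theorem equivalentOn_of_opEquiv {Ω : Set ℂ} {S : ℂ → X →ₗ.[ℂ] X'} {T : ℂ → Y →ₗ.[ℂ] Y'}
    (h : ∀ z ∈ Ω, OpEquiv (S z) (T z)) : EquivalentOn Ω S T := by
  choose E F h using h
  exact ⟨fun z => E z z.2, fun z => F z z.2, fun z => h z z.2⟩

namespace OpEquiv

theorem of_isGivenBy {A : X →ₗ.[ℂ] X'} {B : Y →ₗ.[ℂ] Y'} {S : X → Prop} {S' : Y → Prop}
    {f : X → X'} {g : Y → Y'} (hA : IsGivenBy A S f) (hB : IsGivenBy B S' g)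
    (E : Y' ≃L[ℂ] X') (F : X ≃L[ℂ] Y) (hS : ∀ x, S x ↔ S' (F x))
    (hf : ∀ x, S x → f x = E (g (F x))) : OpEquiv A B :=
  ⟨E, F, hA.eq_of (hB.sandwich _ _) hS hf⟩

theorem refl (A : X →ₗ.[ℂ] X') : OpEquiv A A :=
  ⟨.refl ℂ X', .refl ℂ X, rfl⟩

theorem symm {A : X →ₗ.[ℂ] X'} {B : Y →ₗ.[ℂ] Y'} (h : OpEquiv A B) : OpEquiv B A := by
  obtain ⟨E, F, rfl⟩ := h
  obtain ⟨f, hf⟩ := IsGivenBy.exists_linear B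
  exact of_isGivenBy hf (hf.sandwich _ _) E.symm F.symm (by simp) (by simp)

theorem trans {A : X →ₗ.[ℂ] X'} {B : Y →ₗ.[ℂ] Y'} {C : Z →ₗ.[ℂ] Z'} (h : OpEquiv A B)
    (h' : OpEquiv B C) : OpEquiv A C := by
  obtain ⟨E, F, rfl⟩ := h
  obtain ⟨E', F', rfl⟩ := h'
  exact ⟨E'.trans E, F.trans F', rfl⟩

theorem opSum {W W' : Type*} [NormedAddCommGroup W] [NormedSpace ℂ W] [NormedAddCommGroup W']
    [NormedSpace ℂ W'] {A : X →ₗ.[ℂ] X'} {B : Y →ₗ.[ℂ] Y'} {C : Z →ₗ.[ℂ] Z'} {D : W →ₗ.[ℂ] W'}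
    (h : OpEquiv A B) (h' : OpEquiv C D) : OpEquiv (opSum A C) (opSum B D) := by
  obtain ⟨E, F, rfl⟩ := h
  obtain ⟨E', F', rfl⟩ := h'
  exact ⟨E.prodCongr E', F.prodCongr F', rfl⟩

theorem full_id (E : X ≃L[ℂ] Y) :
    OpEquiv (full (E : X →L[ℂ] Y)) (full (ContinuousLinearMap.id ℂ X)) :=
  ⟨E, .refl ℂ X, rfl⟩

theorem id_of_equiv (E : X ≃L[ℂ] Y) : OpEquiv (OpLin.full (ContinuousLinearMap.id ℂ X))
    (OpLin.full (ContinuousLinearMap.id ℂ Y)) :=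
  of_isGivenBy (IsGivenBy.full _) (IsGivenBy.full _) E.symm E (by simp) (by simp)

theorem opSum_assoc (A : X →ₗ.[ℂ] X') (B : Y →ₗ.[ℂ] Y') (C : Z →ₗ.[ℂ] Z') :
    OpEquiv (OpLin.opSum (OpLin.opSum A B) C) (OpLin.opSum A (OpLin.opSum B C)) := by
  obtain ⟨f, hf⟩ := IsGivenBy.exists_linear A
  obtain ⟨g, hg⟩ := IsGivenBy.exists_linear B
  obtain ⟨h, hh⟩ := IsGivenBy.exists_linear C
  exact of_isGivenBy ((hf.opSum hg).opSum hh) (hf.opSum (hg.opSum hh))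
    (ContinuousLinearEquiv.prodAssoc ℂ X' Y' Z').symm (ContinuousLinearEquiv.prodAssoc ℂ X Y Z)
    (fun x => and_assoc) (fun x _ => rfl)

end OpEquiv

end Similarity

/-! ### Scalar-type recursions for the rows of `E`, `F` and `W` -/

section Algebra

variable {X Y : Type*} [AddCommGroup X] [AddCommGroup Y]

/-- The extension of a finite sequence by zero. -/
def zeroExt {d : ℕ} (x : Fin d → X) (c : ℕ) : X := if h : c < d then x ⟨c, h⟩ else 0

theorem zeroExt_of_lt {d : ℕ} (x : Fin d → X) {c : ℕ} (h : c < d) : zeroExt x c = x ⟨c, h⟩ :=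
  dif_pos h

@[simp]
theorem zeroExt_val {d : ℕ} (x : Fin d → X) (c : Fin d) : zeroExt x c = x c :=
  zeroExt_of_lt x c.2

theorem sum_fin_eq_zeroExt {d : ℕ} (x : Fin d → X) (φ : ℕ → X → Y) :
    ∑ c : Fin d, φ c (x c) = ∑ c ∈ Finset.range d, φ c (zeroExt x c) := by
  rw [← Fin.sum_univ_eq_sum_range (fun c => φ c (zeroExt x c)) d]
  simp

variable [Module ℂ X] [Module ℂ Y]

/-- The entries of the first rows of the blocks of `E`. -/
def firstRow (C : ℕ → X →ₗ[ℂ] Y) (d l : ℕ) (z : ℂ) (c : ℕ) : X →ₗ[ℂ] Y :=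
  if c < d - l then -∑ k ∈ Finset.range (c + 1), z ^ k • C (d - c + k)
  else ∑ k ∈ Finset.range (d - c), (z ^ (d - c - k))⁻¹ • C k

/-- The coordinates of the image under a block of `F`. -/
def colF (d l : ℕ) (z : ℂ) (x : ℕ → X) (r : ℕ) : X :=
  z ^ (d - 1 - r) • x 0 + (if r + 1 < d - l then x (r + 1) else 0) +
    (if d - l ≤ r then x r else 0)

/-- The coordinates in the rows `r ≥ 1` of the image under a diagonal block of `E`. -/
def rowE (d l : ℕ) (z : ℂ) (y : ℕ → X) (r : ℕ) : X :=
  ∑ c ∈ Finset.range d, if c < d - l then if r ≤ c then z ^ (c - r) • y c else 0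
    else if r = c then y c else 0

/-- The coordinates of the image under a block of `W`. -/
def rowW (d l : ℕ) (z : ℂ) (x : ℕ → X) (s : ℕ) : X :=
  (if s < d - l - 1 then x s else -z • x s) +
    if 1 ≤ s ∧ d - l - 1 ≤ s - 1 then x (s - 1) else 0

theorem firstRow_zero (C : ℕ → X →ₗ[ℂ] Y) {d l : ℕ} (hl : l < d) (z : ℂ) :
    firstRow C d l z 0 = -C d := by
  simp [firstRow, hl]

theorem firstRow_top (C : ℕ → X →ₗ[ℂ] Y) {d l : ℕ} (z : ℂ) :
    firstRow C d l z d = 0 := by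
  by_cases h : d < d - l
  · omega
  · simp [firstRow, h]

/-- Below the pivot, removing the term `k = 0` from the entry at `c + 1` leaves `z` times the entry
at `c`. Above it, multiplying the entry at `c` by `z` lowers each negative power by one and turns
its last term into the coefficient `C (d - 1 - c)`. The second computation needs `z ≠ 0`, but it
occurs only for `l > 0`. -/
theorem firstRow_succ (C : ℕ → X →ₗ[ℂ] Y) {d l : ℕ} {z : ℂ} (hz : l = 0 ∨ z ≠ 0) {c : ℕ}
    (hc : c < d) (hne : c ≠ d - l - 1) :
    C (d - 1 - c) - z • firstRow C d l z c + firstRow C d l z (c + 1) = 0 := by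
  by_cases h : c < d - l
  · have h' : c + 1 < d - l := by omega
    rw [firstRow, firstRow, if_pos h, if_pos h', Finset.sum_range_succ' _ (c + 1), smul_neg,
      Finset.smul_sum]
    have : ∀ k, z ^ (k + 1) • C (d - (c + 1) + (k + 1)) = z • z ^ k • C (d - c + k) := fun k => by
      rw [smul_smul, pow_succ', show d - (c + 1) + (k + 1) = d - c + k by omega]
    simp only [this]
    rw [pow_zero, one_smul, add_zero, show d - (c + 1) = d - 1 - c by omega]
    abel
  · have hz0 : z ≠ 0 := hz.resolve_left (by omega)
    have h' : ¬ c + 1 < d - l := by omega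
    obtain ⟨m, hm⟩ : ∃ m, d - c = m + 1 := ⟨d - c - 1, by omega⟩
    rw [firstRow, firstRow, if_neg h, if_neg h', hm, show d - (c + 1) = m by omega,
      show d - 1 - c = m by omega, Finset.sum_range_succ, smul_add, Finset.smul_sum,
      Finset.sum_congr rfl (g := fun k => (z ^ (m - k))⁻¹ • C k)]
    · rw [show m + 1 - m = 1 by omega, pow_one, smul_smul, mul_inv_cancel₀ hz0, one_smul]
      abel
    · intro k hk
      rw [Finset.mem_range] at hk
      rw [smul_smul, show m + 1 - k = (m - k) + 1 by omega, pow_succ', mul_inv, ← mul_assoc,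
        mul_inv_cancel₀ hz0, one_mul]

/-- Here the two formulas for the entries meet: the entry after the pivot contributes the powers
below `l`, the entry at the pivot those above `l`, and the bare coefficient is the term of index
`l`. -/
theorem firstRow_pivot (C : ℕ → X →ₗ[ℂ] Y) {d l : ℕ} (hl : l < d) {z : ℂ} (hz : l = 0 ∨ z ≠ 0) :
    z ^ l • (C (d - 1 - (d - l - 1)) - z • firstRow C d l z (d - l - 1) +
      firstRow C d l z (d - l - 1 + 1)) = ∑ k ∈ Finset.range (d + 1), z ^ k • C k := by
  rw [firstRow, firstRow, if_pos (by omega), if_neg (by omega),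
    show d - (d - l - 1 + 1) = l by omega, show d - 1 - (d - l - 1) = l by omega,
    show d - l - 1 + 1 = d - l by omega, smul_add, smul_sub, smul_neg, smul_neg, sub_neg_eq_add,
    show d + 1 = l + (1 + (d - l)) by omega, Finset.sum_range_add, Finset.sum_range_add,
    Finset.sum_range_one, add_comm]
  congr 1
  · rw [Finset.smul_sum]
    refine Finset.sum_congr rfl fun k hk => ?_
    rw [Finset.mem_range] at hk
    have hz0 : z ≠ 0 := hz.resolve_left (by omega)
    rw [smul_smul, ← pow_sub₀ z hz0 (by omega), show l - (l - k) = k by omega]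
  · rw [add_zero, Finset.smul_sum, Finset.smul_sum]
    congr 1
    refine Finset.sum_congr rfl fun k hk => ?_
    rw [smul_smul, smul_smul, show d - (d - l - 1) + k = l + (1 + k) by omega]
    congr 1
    ring

theorem colF_pivot {d l : ℕ} (hl : l < d) (z : ℂ) (x : ℕ → X) :
    colF d l z x (d - l - 1) = z ^ l • x 0 := by
  rw [colF, if_neg (by omega), if_neg (by omega), add_zero, add_zero,
    show d - 1 - (d - l - 1) = l by omega]

/-- The contribution of one column to the first row of `E (T - z) F`. -/
theorem sum_firstRow_colF (C : ℕ → X →ₗ[ℂ] Y) {d l : ℕ} (hl : l < d) {z : ℂ}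
    (hz : l = 0 ∨ z ≠ 0) (x : ℕ → X) :
    ∑ c ∈ Finset.range d, C (d - 1 - c) (colF d l z x c) + z • C d (colF d l z x 0) +
      ∑ c ∈ Finset.range (d - 1), firstRow C d l z (c + 1)
        (colF d l z x c - z • colF d l z x (c + 1)) =
      ∑ k ∈ Finset.range (d + 1), z ^ k • C k (x 0) := by
  set u := colF d l z x with hu
  set e := firstRow C d l z with he
  have h1 : ∑ c ∈ Finset.range (d - 1), e (c + 1) (u c) = ∑ c ∈ Finset.range d, e (c + 1) (u c) := by
    obtain ⟨m, rfl⟩ : ∃ m, d = m + 1 := ⟨d - 1, by omega⟩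
    rw [Finset.sum_range_succ, he, firstRow_top]
    simp
  have h2 : ∑ c ∈ Finset.range (d - 1), z • e (c + 1) (u (c + 1)) =
      ∑ c ∈ Finset.range d, z • e c (u c) + z • C d (u 0) := by
    obtain ⟨m, rfl⟩ : ∃ m, d = m + 1 := ⟨d - 1, by omega⟩
    rw [Finset.sum_range_succ', he, firstRow_zero C hl]
    simp
  -- After summation by parts, every term except the pivot is annihilated by the recursion.
  have h3 : ∑ c ∈ Finset.range d, (C (d - 1 - c) - z • e c + e (c + 1)) (u c) =
      ∑ k ∈ Finset.range (d + 1), z ^ k • C k (x 0) := by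
    rw [Finset.sum_eq_single_of_mem (d - l - 1) (Finset.mem_range.2 (by omega))]
    · rw [hu, colF_pivot hl, map_smul, ← LinearMap.smul_apply, he, firstRow_pivot C hl hz]
      simp
    · intro c hc hne
      rw [he, firstRow_succ C hz (Finset.mem_range.1 hc) hne, LinearMap.zero_apply]
  rw [← h3]
  simp only [map_sub, map_smul, Finset.sum_sub_distrib, LinearMap.add_apply, LinearMap.sub_apply,
    LinearMap.smul_apply, Finset.sum_add_distrib, h1, h2]
  abel

/-- Row `r` consists of powers `z ^ (c - r)`, so Horner's scheme gives it from row `r + 1`. This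
inverts the triangular part by one subtraction. -/
theorem rowE_eq (d l : ℕ) (z : ℂ) (y : ℕ → X) {r : ℕ} (hr : r < d) :
    rowE d l z y r = y r + if r + 1 < d - l then z • rowE d l z y (r + 1) else 0 := by
  have key : ∀ c ∈ Finset.range d,
      (if c < d - l then if r ≤ c then z ^ (c - r) • y c else 0 else if r = c then y c else 0) =
      (if r = c then y c else 0) + if r + 1 < d - l then
        z • (if c < d - l then if r + 1 ≤ c then z ^ (c - (r + 1)) • y c else 0
          else if r + 1 = c then y c else 0) else 0 := by
    intro c hc
    by_cases h1 : c < d - l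
    · rcases lt_trichotomy r c with h | h | h
      · rw [if_pos h1, if_pos h.le, if_neg h.ne, if_pos (by omega), if_pos h1,
          if_pos (Nat.succ_le_of_lt h), zero_add, smul_smul, ← pow_succ', show c - (r + 1) + 1 = c - r by omega]
      · subst h
        simp [h1]
      · simp [h1, h.ne', not_le.2 h, not_le.2 (h.trans (Nat.lt_succ_self r))]
    · by_cases h2 : r + 1 < d - l
      · simp [h1, h2, show r ≠ c by omega, show r + 1 ≠ c by omega]
      · simp [h1, h2]
  rw [rowE, Finset.sum_congr rfl key, Finset.sum_add_distrib, Finset.sum_ite_eq,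
    if_pos (Finset.mem_range.2 hr)]
  split_ifs
  · rw [← Finset.smul_sum, rowE]
  · simp

/-- The recursion runs downwards from `r = d - 1` and therefore determines all rows; the induction
is on `d - r`. -/
theorem rowE_unique {d l : ℕ} {z : ℂ} {y w : ℕ → X}
    (hw : ∀ r, 1 ≤ r → r < d → w r = y r + if r + 1 < d - l then z • w (r + 1) else 0)
    {r : ℕ} (hr : 1 ≤ r) (hrd : r < d) : rowE d l z y r = w r := by
  obtain ⟨m, hm⟩ : ∃ m, d = r + m := ⟨d - r, by omega⟩
  induction m generalizing r with
  | zero => omega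
  | succ m ih =>
    rw [rowE_eq d l z y hrd, hw r hr hrd]
    split_ifs with h
    · rw [ih (by omega) (by omega) (by omega)]
    · rfl

/-- It suffices that the right-hand side satisfies the same downward recursion. The powers of `z`
times `x 0` cancel in each difference of consecutive coordinates of `F x`, and the three cases place
the row before, at or after the switch from identity to `-z` in `W`. -/
theorem rowE_colF {d l : ℕ} (hl : l < d) (z : ℂ) (x y : ℕ → X)
    (hy : ∀ r, 1 ≤ r → r < d → y r = colF d l z x (r - 1) - z • colF d l z x r)
    {r : ℕ} (hr : 1 ≤ r) (hrd : r < d) :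
    rowE d l z y r = rowW d l z (fun c => x (c + 1)) (r - 1) := by
  refine rowE_unique (w := fun r => rowW d l z (fun c => x (c + 1)) (r - 1)) ?_ hr hrd
  intro r hr hrd
  obtain ⟨s, rfl⟩ : ∃ s, r = s + 1 := ⟨r - 1, by omega⟩
  have hp : z • z ^ (d - 1 - (s + 1)) • x 0 = z ^ (d - 1 - s) • x 0 := by
    rw [smul_smul, ← pow_succ', show d - 1 - (s + 1) + 1 = d - 1 - s by omega]
  simp only [hy _ hr hrd, rowW, colF, Nat.add_sub_cancel, smul_add, hp]
  rcases lt_trichotomy (s + 1) (d - l - 1) with h | h | h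
  · have a1 : s < d - l - 1 := by omega
    have a2 : ¬ (1 ≤ s ∧ d - l - 1 ≤ s - 1) := by omega
    have a3 : s + 1 < d - l := by omega
    have a4 : ¬ d - l ≤ s := by omega
    have a5 : s + 1 + 1 < d - l := by omega
    have a6 : ¬ d - l ≤ s + 1 := by omega
    have a7 : ¬ (1 ≤ s + 1 ∧ d - l - 1 ≤ s) := by omega
    simp only [a1, a2, a3, a4, a5, a6, a7, h, if_true, if_false]
    module
  · have a1 : s < d - l - 1 := by omega
    have a2 : ¬ (1 ≤ s ∧ d - l - 1 ≤ s - 1) := by omega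
    have a3 : s + 1 < d - l := by omega
    have a4 : ¬ d - l ≤ s := by omega
    have a5 : ¬ s + 1 + 1 < d - l := by omega
    have a6 : ¬ d - l ≤ s + 1 := by omega
    simp only [a1, a2, a3, a4, a5, a6, if_true, if_false]
    module
  · have a1 : ¬ s < d - l - 1 := by omega
    have a3 : ¬ s + 1 < d - l := by omega
    have a5 : ¬ s + 1 + 1 < d - l := by omega
    have a6 : d - l ≤ s + 1 := by omega
    simp only [a1, a3, a5, a6, if_true, if_false]
    by_cases a4 : d - l ≤ s
    · have a2 : 1 ≤ s ∧ d - l - 1 ≤ s - 1 := by omega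
      simp only [a2, a4, and_self, if_true, show s - 1 + 1 = s by omega]
      module
    · have a2 : ¬ (1 ≤ s ∧ d - l - 1 ≤ s - 1) := by omega
      simp only [a2, a4, if_false]
      module

theorem colF_bijective {d l : ℕ} (hl : l < d) {z : ℂ} (hz : l = 0 ∨ z ≠ 0) :
    Function.Bijective fun (x : Fin d → X) (r : Fin d) => colF d l z (zeroExt x) r := by
  have hzl : z ^ l ≠ 0 := by
    rcases hz with rfl | hz
    · simp
    · exact pow_ne_zero _ hz
  constructor
  · intro x y hxy
    have h : ∀ r, r < d → colF d l z (zeroExt x) r = colF d l z (zeroExt y) r := fun r hr =>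
      congrFun hxy ⟨r, hr⟩
    have h0 : zeroExt x 0 = zeroExt y 0 := by
      have := h (d - l - 1) (by omega)
      rwa [colF_pivot hl, colF_pivot hl, smul_right_inj hzl] at this
    funext ⟨c, hc⟩
    rw [← zeroExt_of_lt x hc, ← zeroExt_of_lt y hc]
    rcases Nat.eq_zero_or_pos c with rfl | hc0
    · exact h0
    by_cases hcl : c < d - l
    · have := h (c - 1) (by omega)
      simpa [colF, h0, show c - 1 + 1 = c by omega, hcl, show ¬ d - l ≤ c - 1 by omega] using this
    · have := h c hc
      simpa [colF, h0, show ¬ c + 1 < d - l by omega, not_lt.1 hcl] using this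
  · intro v
    -- The pivot coordinate determines `x 0`; each other coordinate then determines one further
    -- component.
    let x0 : X := (z ^ l)⁻¹ • zeroExt v (d - l - 1)
    let x : Fin d → X := fun c => if (c : ℕ) = 0 then x0 else if (c : ℕ) < d - l then
      zeroExt v (c - 1) - z ^ (d - 1 - (c - 1)) • x0 else zeroExt v c - z ^ (d - 1 - c) • x0
    have hx0 : zeroExt x 0 = x0 := by rw [zeroExt_of_lt x (by omega)]; simp [x]
    refine ⟨x, funext fun r => ?_⟩
    obtain ⟨r, hr⟩ := r
    rw [← zeroExt_of_lt v hr]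
    simp only
    rcases lt_trichotomy r (d - l - 1) with h | h | h
    · have hx : zeroExt x (r + 1) = zeroExt v r - z ^ (d - 1 - r) • x0 := by
        rw [zeroExt_of_lt x (by omega)]
        simp [x, show r + 1 < d - l by omega]
      simp [colF, hx0, hx, show r + 1 < d - l by omega, show ¬ d - l ≤ r by omega]
    · rw [h, colF_pivot hl, hx0]
      simp only [x0]
      rw [smul_inv_smul₀ hzl]
    · have hx : zeroExt x r = zeroExt v r - z ^ (d - 1 - r) • x0 := by
        rw [zeroExt_of_lt x hr]
        simp [x, show ¬ r < d - l by omega, show r ≠ 0 by omega, zeroExt_of_lt v hr]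
      rw [colF, hx0, hx, if_neg (by omega), if_pos (by omega)]
      abel

theorem rowW_bijective {d l m : ℕ} {z : ℂ} (hz : d - l - 1 = m ∨ z ≠ 0) :
    Function.Bijective fun (x : Fin m → X) (r : Fin m) => rowW d l z (zeroExt x) r := by
  -- `a` is the diagonal of a lower bidiagonal matrix. If `d - l - 1 = m`, all of its entries are
  -- `1`, so `z = 0` is harmless.
  obtain ⟨a, ha⟩ : ∃ a : ℕ → ℂ, a = fun s => if s < d - l - 1 then 1 else -z := ⟨_, rfl⟩
  have ha0 : ∀ s < m, a s ≠ 0 := by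
    intro s hs
    rw [ha]
    by_cases h : s < d - l - 1
    · simp [h]
    · simpa [h] using hz.resolve_left (by omega)
  have hW : ∀ (x : ℕ → X) s, rowW d l z x s =
      a s • x s + if 1 ≤ s ∧ d - l - 1 ≤ s - 1 then x (s - 1) else 0 := by
    intro x s
    rw [rowW, ha]
    by_cases h : s < d - l - 1 <;> simp [h]
  constructor
  · intro x y hxy
    have key : ∀ s, s < m → zeroExt x s = zeroExt y s := by
      intro s
      induction s with
      | zero =>
        intro hs
        have h := congrFun hxy ⟨0, hs⟩
        simp only [hW] at h
        simpa [ha0 0 hs] using h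
      | succ s ih =>
        intro hs
        have h := congrFun hxy ⟨s + 1, hs⟩
        simp only [hW, Nat.add_sub_cancel, ih (by omega), add_left_inj] at h
        exact (smul_right_inj (ha0 _ hs)).1 h
    funext c
    rw [← zeroExt_val x, ← zeroExt_val y]
    exact key c c.2
  · intro v
    -- Forward substitution along the subdiagonal.
    let x : ℕ → X := fun s => Nat.rec ((a 0)⁻¹ • zeroExt v 0) (fun s xs =>
      (a (s + 1))⁻¹ • (zeroExt v (s + 1) - if d - l - 1 ≤ s then xs else 0)) s
    have hx : ∀ s, x (s + 1) =
      (a (s + 1))⁻¹ • (zeroExt v (s + 1) - if d - l - 1 ≤ s then x s else 0) := fun _ => rfl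
    have he : ∀ s < m, zeroExt (fun c : Fin m => x c) s = x s := fun s hs => zeroExt_of_lt _ hs
    refine ⟨fun c => x c, funext fun ⟨s, hs⟩ => ?_⟩
    rw [← zeroExt_of_lt v hs]
    simp only [hW]
    cases s with
    | zero =>
      rw [he 0 hs, show x 0 = (a 0)⁻¹ • zeroExt v 0 from rfl, smul_inv_smul₀ (ha0 0 hs)]
      simp
    | succ s =>
      rw [he _ hs, Nat.add_sub_cancel, he s (by omega), hx, smul_inv_smul₀ (ha0 _ hs)]
      simp

end Algebra

/-! ### Coordinate formulas for `P`, `W`, `E`, `F` and `T` -/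

namespace IsGivenBy

variable {X Y : Type*} [NormedAddCommGroup X] [NormedSpace ℂ X]
  [NormedAddCommGroup Y] [NormedSpace ℂ Y]

theorem of_isBoundedOp {A : X →ₗ.[ℂ] Y} {S : X → Prop} {f g : X → Y} (hA : IsGivenBy A S f)
    (hb : IsBoundedOp A) (hfg : ∀ x, f x = g x) : IsGivenBy A (fun _ => True) g :=
  ⟨fun x => iff_of_true (hb.mem_domain x) trivial, fun x hx => (hA.apply_eq x hx).trans (hfg x)⟩

end IsGivenBy

namespace OpMatrixPoly

variable {n : ℕ} {H : Fin n → Type u}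
  [∀ i, NormedAddCommGroup (H i)] [∀ i, NormedSpace ℂ (H i)]

theorem sum_delta (g : ∀ i, H i) (j : Fin n) : ∑ i, delta j i (g i) = g j := by
  have h : ∀ i, delta j i (g i) = Pi.single (M := H) i (g i) j := fun i => rfl
  rw [Finset.sum_congr rfl fun i _ => h i, ← Finset.sum_apply, Finset.univ_sum_single]

/-- The elements that lie in the domains of all the coefficients `coeff j i (l i)`. -/
def colDomain (P : OpMatrixPoly H) (l : Fin n → ℕ) (i : Fin n) (x : H i) : Prop :=
  ∀ j, x ∈ (P.coeff j i (l i)).domain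

theorem smul_mem_colDomain_iff (P : OpMatrixPoly H) (l : Fin n → ℕ) (i : Fin n) {c : ℂ}
    (hc : c ≠ 0) (x : H i) : P.colDomain l i (c • x) ↔ P.colDomain l i x :=
  forall_congr' fun _ => Submodule.smul_mem_iff _ hc

section Bounded

variable {P : OpMatrixPoly H} {l : Fin n → ℕ}

theorem mem_domain_of_colDomain (hbdd : ∀ j i k, k ≠ l i → IsBoundedOp (P.coeff j i k)) {i : Fin n} {x : H i} (hx : P.colDomain l i x) (j : Fin n)
    (k : ℕ) : x ∈ (P.coeff j i k).domain := by
  by_cases h : k = l i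
  · rw [h]
    exact hx j
  · exact (hbdd j i k h).mem_domain x

theorem colDomain_of_lt_deg {i : Fin n} {x : H i}
    (hx : ∀ j, ∀ k ∈ Finset.range (P.deg j i + 1), x ∈ (P.coeff j i k).domain) :
    P.colDomain l i x := by
  intro j
  by_cases h : P.deg j i < l i
  · rw [P.coeff_eq_zero j i _ h]
    exact Submodule.mem_top
  · exact hx j _ (Finset.mem_range.2 (by omega))

end Bounded

section Formulas

variable {P : OpMatrixPoly H} {l : Fin n → ℕ} {C : ∀ j i : Fin n, ℕ → H i →ₗ[ℂ] H j}

/-- The linear maps `C j i k` are everywhere defined extensions of the coefficients of `P`. -/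
def IsExtension (P : OpMatrixPoly H) (C : ∀ j i : Fin n, ℕ → H i →ₗ[ℂ] H j) : Prop :=
  ∀ j i k, IsGivenBy (P.coeff j i k) (fun x => x ∈ (P.coeff j i k).domain) (C j i k)

theorem exists_isExtension (P : OpMatrixPoly H) :
    ∃ C : ∀ j i : Fin n, ℕ → H i →ₗ[ℂ] H j, P.IsExtension C := by
  choose C hC using fun j i k => IsGivenBy.exists_linear (P.coeff j i k)
  exact ⟨C, hC⟩

theorem IsExtension.eq_zero (hC : P.IsExtension C) {j i : Fin n} {k : ℕ} (hk : P.deg j i < k) :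
    C j i k = 0 := by
  have h := hC j i k
  rw [P.coeff_eq_zero j i k hk] at h
  exact LinearMap.ext fun x => (h.apply_eq x Submodule.mem_top).symm

/-- All sums can be extended to `d i`, since the additional coefficients vanish, and only the
coefficients of index `l i` restrict the domain. -/
theorem isGivenBy_eval (hC : P.IsExtension C)
    (hdeg : ∀ j i, j ≠ i → P.deg j i < P.d i)
    (hbdd : ∀ j i k, k ≠ l i → IsBoundedOp (P.coeff j i k)) (z : ℂ) :
    IsGivenBy (P.eval z) (fun x => ∀ i, P.colDomain l i (x i))
      (fun x j => ∑ i, ∑ k ∈ Finset.range (P.d i + 1), z ^ k • C j i k (x i)) := by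
  refine (IsGivenBy.opMatrix fun j i => IsGivenBy.sum _ fun k => (hC j i k).smul _).congr
    (fun x => ⟨fun h i => colDomain_of_lt_deg fun j => h j i, fun h j i k _ =>
      mem_domain_of_colDomain hbdd (h i) j k⟩) fun x _ => funext fun j =>
      Finset.sum_congr rfl fun i _ => ?_
  refine Finset.sum_subset ?_ fun k _ hk => ?_
  · rw [Finset.range_subset_range]
    by_cases h : j = i
    · rw [h]
    · have := hdeg j i h
      omega
  · rw [Finset.mem_range, not_lt] at hk
    rw [hC.eq_zero hk, LinearMap.zero_apply, smul_zero]

theorem isBoundedOp_matF (P : OpMatrixPoly H) (l : Fin n → ℕ) (z : ℂ) :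
    IsBoundedOp (P.matF l z) := by
  refine IsBoundedOp.opDiag fun i => IsBoundedOp.opMatrix fun r c => ?_
  split_ifs
  all_goals first | exact IsBoundedOp.full _ | exact IsBoundedOp.zero

theorem isBoundedOp_extW (P : OpMatrixPoly H) (l : Fin n → ℕ) (z : ℂ) :
    IsBoundedOp (P.extW l z) := by
  refine IsBoundedOp.opDiag fun i => IsBoundedOp.opMatrix fun r c => ?_
  split_ifs
  all_goals first | exact IsBoundedOp.full _ | exact IsBoundedOp.zero

/-- The indices in part `α` are at least `d i - c > l i` and those in part `β` are below `d i - c ≤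
l i`, so the possibly unbounded coefficient is never used. -/
theorem isBoundedOp_matE (hl : ∀ i, l i < P.d i)
    (hbdd : ∀ j i k, k ≠ l i → IsBoundedOp (P.coeff j i k)) (z : ℂ) :
    IsBoundedOp (P.matE l z) := by
  refine IsBoundedOp.opMatrix fun j i => IsBoundedOp.opMatrix fun r c => ?_
  have hc := c.2
  have := hl i
  split_ifs with h1 h2
  · refine (IsBoundedOp.sum _ fun k _ => (hbdd j i _ ?_).smul _).neg
    omega
  · refine (IsBoundedOp.sum _ fun k _ => (hbdd j i _ ?_).smul _).neg
    omega
  · refine IsBoundedOp.sum _ fun k hk => (hbdd j i _ ?_).smul _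
    rw [Finset.mem_range] at hk
    omega
  all_goals first | exact IsBoundedOp.full _ | exact IsBoundedOp.zero

theorem isGivenBy_matF (P : OpMatrixPoly H) (hl : ∀ i, l i < P.d i) (z : ℂ) :
    IsGivenBy (P.matF l z) (fun _ => True)
      (fun x i r => colF (P.d i) (l i) z (zeroExt (x i)) r) := by
  refine (IsGivenBy.opDiag fun i => IsGivenBy.opMatrix fun r c =>
    (IsGivenBy.full _).ite (((IsGivenBy.full _).ite IsGivenBy.zero).ite
      ((IsGivenBy.full _).ite IsGivenBy.zero))).of_isBoundedOp (P.isBoundedOp_matF l z)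
    fun x => funext fun i => funext fun r => ?_
  have hd := hl i
  have hr := r.2
  simp only [Fin.ext_iff, FunLike.coe_smul, Pi.smul_apply,
    ContinuousLinearMap.coe_id', id_eq]
  rw [sum_fin_eq_zeroExt (x i) (fun c y => if c = 0 then z ^ (P.d i - 1 - r) • y else
    if c < P.d i - l i then if (r : ℕ) + 1 = c then y else 0 else if (r : ℕ) = c then y else 0)]
  have key : ∀ c ∈ Finset.range (P.d i), (if c = 0 then z ^ (P.d i - 1 - r) • zeroExt (x i) c else
      if c < P.d i - l i then if (r : ℕ) + 1 = c then zeroExt (x i) c else 0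
        else if (r : ℕ) = c then zeroExt (x i) c else 0) =
      ((if 0 = c then z ^ (P.d i - 1 - r) • zeroExt (x i) c else 0) +
        if r + 1 = c then (if c < P.d i - l i then zeroExt (x i) c else 0) else 0) +
        if r = c then (if P.d i - l i ≤ c then zeroExt (x i) c else 0) else 0 := by
    intro c _
    rcases Nat.eq_zero_or_pos c with rfl | hc
    · simp [show P.d i - l i ≠ 0 by omega]
    · rw [if_neg hc.ne', if_neg hc.ne, zero_add]
      by_cases h : c < P.d i - l i
      · simp [h, not_le.2 h]
      · simp [h, not_lt.1 h]
  rw [Finset.sum_congr rfl key, Finset.sum_add_distrib, Finset.sum_add_distrib,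
    Finset.sum_ite_eq, Finset.sum_ite_eq, Finset.sum_ite_eq, colF]
  have h0 : 0 ∈ Finset.range (P.d i) := Finset.mem_range.2 (by omega)
  have h1 : (r : ℕ) ∈ Finset.range (P.d i) := Finset.mem_range.2 hr
  rw [if_pos h0, if_pos h1]
  congr 2
  by_cases h : (r : ℕ) + 1 < P.d i - l i
  · rw [if_pos (Finset.mem_range.2 (by omega))]
  · simp [h]

theorem isGivenBy_extW (P : OpMatrixPoly H) (hl : ∀ i, l i ≤ P.d i) (z : ℂ) :
    IsGivenBy (P.extW l z) (fun _ => True)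
      (fun x i s => rowW (P.d i) (l i) z (zeroExt (x i)) s) := by
  refine (IsGivenBy.opDiag fun i => IsGivenBy.opMatrix fun r c =>
    ((IsGivenBy.full _).ite (IsGivenBy.full _)).ite
      ((IsGivenBy.full _).ite IsGivenBy.zero)).of_isBoundedOp (P.isBoundedOp_extW l z)
    fun x => funext fun i => funext fun r => ?_
  have hd := hl i
  have hr := r.2
  simp only [Fin.ext_iff, FunLike.coe_smul, Pi.smul_apply,
    ContinuousLinearMap.coe_id', id_eq]
  rw [sum_fin_eq_zeroExt (x i) (fun c y => if (r : ℕ) = c then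
    if c < P.d i - l i - 1 then y else -z • y
    else if (r : ℕ) = c + 1 ∧ P.d i - l i - 1 ≤ c then y else 0)]
  have key : ∀ c ∈ Finset.range (max (P.d i - 1) (l i)),
      (if (r : ℕ) = c then
        if c < P.d i - l i - 1 then zeroExt (x i) c else -z • zeroExt (x i) c
        else if (r : ℕ) = c + 1 ∧ P.d i - l i - 1 ≤ c then zeroExt (x i) c else 0) =
      (if (r : ℕ) = c then
        if c < P.d i - l i - 1 then zeroExt (x i) c else -z • zeroExt (x i) c else 0) +
      if (r : ℕ) - 1 = c then
        if 1 ≤ (r : ℕ) ∧ P.d i - l i - 1 ≤ c then zeroExt (x i) c else 0 else 0 := by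
    intro c _
    by_cases h : (r : ℕ) = c
    · rw [if_pos h, if_pos h, left_eq_add]
      by_cases h' : (r : ℕ) - 1 = c
      · rw [if_pos h', if_neg (by omega)]
      · rw [if_neg h']
    · rw [if_neg h, if_neg h, zero_add]
      by_cases h' : (r : ℕ) = c + 1
      · simp [h']
      · by_cases h'' : (r : ℕ) - 1 = c
        · rw [if_neg (by tauto), if_pos h'', if_neg (by omega)]
        · rw [if_neg (by tauto), if_neg h'']
  rw [Finset.sum_congr rfl key, Finset.sum_add_distrib, Finset.sum_ite_eq, Finset.sum_ite_eq,
    if_pos (Finset.mem_range.2 hr), if_pos (Finset.mem_range.2 (by omega)), rowW]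

theorem isGivenBy_matE (hC : P.IsExtension C) (hl : ∀ i, l i < P.d i)
    (hdeg : ∀ j i, j ≠ i → P.deg j i < P.d i)
    (hbdd : ∀ j i k, k ≠ l i → IsBoundedOp (P.coeff j i k)) (z : ℂ) :
    IsGivenBy (P.matE l z) (fun _ => True)
      (fun u j r => if (r : ℕ) = 0 then ∑ i, ∑ c ∈ Finset.range (P.d i),
          firstRow (C j i) (P.d i) (l i) z c (zeroExt (u i) c)
        else rowE (P.d j) (l j) z (zeroExt (u j)) r) := by
  refine (IsGivenBy.opMatrix fun j i => IsGivenBy.opMatrix fun r c =>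
    (((IsGivenBy.sum _ fun k => (hC j i _).smul _).neg).ite
      (IsGivenBy.sum _ fun k => (hC j i _).smul _)).ite
    ((((IsGivenBy.full _).ite IsGivenBy.zero)).ite
      ((IsGivenBy.full _).ite IsGivenBy.zero))).of_isBoundedOp (isBoundedOp_matE hl hbdd z)
    fun u => funext fun j => funext fun r => ?_
  rw [Finset.sum_apply]
  by_cases hr : (r : ℕ) = 0
  · simp only [hr, if_true]
    refine Finset.sum_congr rfl fun i _ => ?_
    rw [← sum_fin_eq_zeroExt (u i) (fun c y => firstRow (C j i) (P.d i) (l i) z c y)]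
    refine Finset.sum_congr rfl fun c _ => ?_
    rw [firstRow]
    split_ifs with h1 h2
    · simp
    -- Off the diagonal `firstRow` has one more summand, `k = c`; its coefficient has index `d i`
    -- and is zero.
    · rw [LinearMap.neg_apply, LinearMap.sum_apply, Finset.sum_range_succ,
        hC.eq_zero (show P.deg j i < P.d i - c + c by
          have := hdeg j i h2
          have := c.2
          omega)]
      simp
    · simp
  · simp only [hr, if_false]
    rw [rowE, ← sum_fin_eq_zeroExt (u j) (fun c y => if c < P.d j - l j then
      if (r : ℕ) ≤ c then z ^ (c - (r : ℕ)) • y else 0 else if (r : ℕ) = c then y else 0)]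
    rw [← sum_delta (fun i => ∑ c : Fin (P.d i), if (c : ℕ) < P.d i - l i then
      if (r : ℕ) ≤ c then z ^ ((c : ℕ) - (r : ℕ)) • u i c else 0
        else if (r : ℕ) = c then u i c else 0) j]
    refine Finset.sum_congr rfl fun i _ => ?_
    rw [map_sum]
    refine Finset.sum_congr rfl fun c _ => ?_
    split_ifs <;> simp

/-- Column `c` of block `i` carries the coefficients of index `d i - 1 - c`, so only `c = d i - l i
- 1` restricts the domain. Left multiplication by the bounded inverse does not change it. -/
theorem isGivenBy_companion (hC : P.IsExtension C) (hl : ∀ i, l i < P.d i)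
    (hbdd : ∀ j i k, k ≠ l i → IsBoundedOp (P.coeff j i k)) :
    IsGivenBy P.companion
      (fun u => ∀ i, P.colDomain l i (zeroExt (u i) (P.d i - l i - 1)))
      (fun u j r => if (r : ℕ) = 0 then -inv (P.lead j) (∑ i, ∑ c ∈ Finset.range (P.d i),
          C j i (P.d i - 1 - c) (zeroExt (u i) c))
        else zeroExt (u j) (r - 1)) := by
  refine (IsGivenBy.opMatrix fun j i => IsGivenBy.opMatrix fun r c =>
    ((hC j i _).compPMap _).neg.ite ((IsGivenBy.full _).ite IsGivenBy.zero)).congr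
    (fun u => ⟨fun h i j => ?_, fun h j i r c => ?_⟩) fun u _ => funext fun j => funext fun r => ?_
  · have hi := hl i
    have h' := h j i ⟨0, (Nat.zero_le _).trans_lt (hl j)⟩ ⟨P.d i - l i - 1, by omega⟩
    rw [if_pos rfl] at h'
    rw [zeroExt_of_lt _ (by omega)]
    convert h' using 3
    simp only
    omega
  · have hi := hl i
    split_ifs with h1 h2
    · by_cases hc : P.d i - 1 - c = l i
      · have := h i j
        rw [hc]
        rw [zeroExt_of_lt _ (by omega)] at this
        convert this using 3
        have := c.2
        omega
      · exact (hbdd j i _ hc).mem_domain _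
  · rw [Finset.sum_apply]
    by_cases hr : (r : ℕ) = 0
    · simp only [hr, if_true]
      rw [map_sum, ← Finset.sum_neg_distrib]
      refine Finset.sum_congr rfl fun i _ => ?_
      rw [← sum_fin_eq_zeroExt (u i) (fun c y => C j i (P.d i - 1 - c) y), map_sum,
        ← Finset.sum_neg_distrib]
      rfl
    · simp only [hr, if_false]
      rw [← sum_delta (fun i => zeroExt (u i) ((r : ℕ) - 1)) j]
      refine Finset.sum_congr rfl fun i _ => ?_
      have h1 : ∑ c : Fin (P.d i), (if (r : ℕ) = c + 1 then delta j i (u i c) else 0) =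
          ∑ c ∈ Finset.range (P.d i), if (r : ℕ) - 1 = c then delta j i (zeroExt (u i) c) else 0 := by
        rw [sum_fin_eq_zeroExt (u i) (fun c y => if (r : ℕ) = c + 1 then delta j i y else 0)]
        refine Finset.sum_congr rfl fun c _ => if_congr ?_ rfl rfl
        omega
      rw [h1, Finset.sum_ite_eq]
      split_ifs with h
      · rfl
      · rw [Finset.mem_range] at h
        rw [zeroExt, dif_neg h, map_zero]

end Formulas

end OpMatrixPoly

/-! ### The explicit equivalence when all `l i < d i` -/

namespace OpMatrixPoly

variable {n : ℕ} {H : Fin n → Type u}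
  [∀ i, NormedAddCommGroup (H i)] [∀ i, NormedSpace ℂ (H i)]
  {P : OpMatrixPoly H} {l : Fin n → ℕ} {C : ∀ j i : Fin n, ℕ → H i →ₗ[ℂ] H j}

theorem matF_bijective (hl : ∀ i, l i < P.d i) {z : ℂ} (hz : ∀ i, l i = 0 ∨ z ≠ 0) :
    Function.Bijective fun (x : ∀ i, Fin (P.d i) → H i) i (r : Fin (P.d i)) =>
      colF (P.d i) (l i) z (zeroExt (x i)) r :=
  Function.Bijective.piMap fun i => colF_bijective (hl i) (hz i)

theorem extW_bijective (P : OpMatrixPoly H) {z : ℂ} (hz : ∀ i, l i = 0 ∨ z ≠ 0) :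
    Function.Bijective fun (x : P.ExtSpace l) i (s : Fin (max (P.d i - 1) (l i))) =>
      rowW (P.d i) (l i) z (zeroExt (x i)) s :=
  Function.Bijective.piMap fun i => rowW_bijective ((hz i).imp_left fun h => by simp [h])

/-- The rows `r ≥ 1` do not see the components of index `0` and are unitriangular in the others.
Once these are known, each first row is solved for its component of index `0` through the diagonal
leading coefficient. -/
theorem matE_bijective (hC : P.IsExtension C) (hl : ∀ i, l i < P.d i)
    (hdeg : ∀ j i, j ≠ i → P.deg j i < P.d i) (hinv : ∀ i, Function.Bijective (C i i (P.d i)))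
    (z : ℂ) :
    Function.Bijective fun (u : ∀ i, Fin (P.d i) → H i) j (r : Fin (P.d j)) =>
      if (r : ℕ) = 0 then ∑ i, ∑ c ∈ Finset.range (P.d i),
          firstRow (C j i) (P.d i) (l i) z c (zeroExt (u i) c)
        else rowE (P.d j) (l j) z (zeroExt (u j)) r := by
  have hfirst : ∀ (u : ∀ i, Fin (P.d i) → H i) j, ∑ i, ∑ c ∈ Finset.range (P.d i),
      firstRow (C j i) (P.d i) (l i) z c (zeroExt (u i) c) =
      ∑ i, ∑ c ∈ Finset.range (P.d i - 1),
        firstRow (C j i) (P.d i) (l i) z (c + 1) (zeroExt (u i) (c + 1)) -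
        C j j (P.d j) (zeroExt (u j) 0) := by
    intro u j
    have h0 : ∀ i ∈ Finset.univ, ∑ c ∈ Finset.range (P.d i),
        firstRow (C j i) (P.d i) (l i) z c (zeroExt (u i) c) =
        ∑ c ∈ Finset.range (P.d i - 1),
          firstRow (C j i) (P.d i) (l i) z (c + 1) (zeroExt (u i) (c + 1)) -
          C j i (P.d i) (zeroExt (u i) 0) := by
      intro i _
      have hi := hl i
      obtain ⟨m, hm⟩ : ∃ m, P.d i = m + 1 := ⟨P.d i - 1, by omega⟩
      have h := firstRow_zero (C j i) hi z
      rw [show Finset.range (P.d i) = Finset.range (P.d i - 1 + 1) by rw [Nat.sub_add_cancel]; omega,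
        Finset.sum_range_succ', h, LinearMap.neg_apply, sub_eq_add_neg]
    rw [Finset.sum_congr rfl h0, Finset.sum_sub_distrib]
    congr 1
    refine Finset.sum_eq_single_of_mem j (Finset.mem_univ j) fun i _ hij => ?_
    rw [hC.eq_zero (hdeg j i hij.symm), LinearMap.zero_apply]
  constructor
  · intro u v huv
    have hrow : ∀ j r, 1 ≤ r → r < P.d j → rowE (P.d j) (l j) z (zeroExt (u j)) r =
        rowE (P.d j) (l j) z (zeroExt (v j)) r := by
      intro j r hr hrd
      have h := congrFun (congrFun huv j) ⟨r, hrd⟩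
      simpa [show r ≠ 0 by omega] using h
    have hpos : ∀ j r, 1 ≤ r → r < P.d j → zeroExt (u j) r = zeroExt (v j) r := by
      intro j r hr hrd
      have h := hrow j r hr hrd
      rw [rowE_eq _ _ _ _ hrd, rowE_eq _ _ _ _ hrd] at h
      by_cases h' : r + 1 < P.d j - l j
      · rw [hrow j (r + 1) (by omega) (by omega)] at h
        exact add_right_cancel h
      · simpa [h'] using h
    have hzero : ∀ j, zeroExt (u j) 0 = zeroExt (v j) 0 := by
      intro j
      have h := congrFun (congrFun huv j) ⟨0, by have := hl j; omega⟩
      simp only [if_true, hfirst] at h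
      rw [Finset.sum_congr rfl fun i _ => Finset.sum_congr rfl fun c hc => by
        rw [hpos i (c + 1) (by omega) (by rw [Finset.mem_range] at hc; omega)]] at h
      exact (hinv j).1 (sub_right_injective h)
    funext j r
    rw [← zeroExt_val (u j), ← zeroExt_val (v j)]
    rcases Nat.eq_zero_or_pos (r : ℕ) with h | h
    · rw [h, hzero]
    · exact hpos j r h r.2
  · intro v
    -- The preimage in the rows `r ≥ 1`, obtained by solving the recursion of `rowE_eq` for its
    -- inhomogeneity.
    let w : ∀ j, ℕ → H j := fun j r => zeroExt (v j) r -
      if r + 1 < P.d j - l j then z • zeroExt (v j) (r + 1) else 0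
    choose a ha using fun j => (hinv j).2 (∑ i, ∑ c ∈ Finset.range (P.d i - 1),
      firstRow (C j i) (P.d i) (l i) z (c + 1) (w i (c + 1)) - zeroExt (v j) 0)
    let u : ∀ j, Fin (P.d j) → H j := fun j r => if (r : ℕ) = 0 then a j else w j r
    have hu0 : ∀ j, zeroExt (u j) 0 = a j := fun j => by
      rw [zeroExt_of_lt _ ((Nat.zero_le _).trans_lt (hl j))]
      simp [u]
    have hu : ∀ j r, r + 1 < P.d j → zeroExt (u j) (r + 1) = w j (r + 1) := fun j r hr => by
      rw [zeroExt_of_lt _ hr]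
      simp [u]
    refine ⟨u, funext fun j => funext fun r => ?_⟩
    by_cases hr : (r : ℕ) = 0
    · simp only [hr, if_true, hfirst, hu0, ha]
      rw [Finset.sum_congr rfl fun i _ => Finset.sum_congr rfl fun c hc => by
        rw [hu i c (by rw [Finset.mem_range] at hc; omega)], sub_sub_cancel, ← zeroExt_val (v j) r,
        hr]
    · simp only [hr, if_false]
      rw [← zeroExt_val (v j) r]
      refine rowE_unique (fun r hr hrd => ?_) (Nat.one_le_iff_ne_zero.2 hr) r.2
      obtain ⟨s, rfl⟩ : ∃ s, r = s + 1 := ⟨r - 1, by omega⟩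
      rw [hu j s hrd]
      simp [w]

theorem regroup_apply (P : OpMatrixPoly H) (hl : ∀ i, l i < P.d i)
    (x : (∀ i, H i) × P.ExtSpace l) (i : Fin n) (r : Fin (P.d i)) :
    P.regroup l hl x i r = if (r : ℕ) = 0 then x.1 i else zeroExt (x.2 i) (r - 1) := by
  by_cases h : (r : ℕ) = 0
  · simp [regroup, h]
  · have := r.2
    rw [zeroExt_of_lt _ (by omega)]
    simp [regroup, h]

theorem regroup_symm_fst (P : OpMatrixPoly H) (hl : ∀ i, l i < P.d i)
    (u : ∀ i, Fin (P.d i) → H i) (i : Fin n) :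
    ((P.regroup l hl).symm u).1 i = zeroExt (u i) 0 := by
  rw [zeroExt_of_lt _ ((Nat.zero_le _).trans_lt (hl i))]
  rfl

theorem regroup_symm_snd (P : OpMatrixPoly H) (hl : ∀ i, l i < P.d i)
    (u : ∀ i, Fin (P.d i) → H i) (i : Fin n) (s : ℕ) :
    zeroExt (((P.regroup l hl).symm u).2 i) s = zeroExt (u i) (s + 1) := by
  have hi := hl i
  by_cases h : s + 1 < P.d i
  · rw [zeroExt_of_lt _ h, zeroExt_of_lt _ (by omega)]
    rfl
  · rw [zeroExt, zeroExt, dif_neg h, dif_neg (by omega)]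

/-- The explicit equivalence of `P ⊕ W` and `T - z` if `l i < d i` for all `i`. -/
theorem exists_explicit_equivalence [∀ i, CompleteSpace (H i)]
    (hdeg : ∀ j i, j ≠ i → P.deg j i < P.d i) (hinv : ∀ i, Invertible (P.lead i))
    (hbdd : ∀ j i k, k ≠ l i → IsBoundedOp (P.coeff j i k)) (hl : ∀ i, l i < P.d i)
    {z : ℂ} (hz : ∀ i, l i = 0 ∨ z ≠ 0) :
    ∃ E F : (∀ i, Fin (P.d i) → H i) ≃L[ℂ] (∀ i, Fin (P.d i) → H i),
      P.matE l z = full (E : (∀ i, Fin (P.d i) → H i) →L[ℂ] (∀ i, Fin (P.d i) → H i)) ∧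
      P.matF l z = full (F : (∀ i, Fin (P.d i) → H i) →L[ℂ] (∀ i, Fin (P.d i) → H i)) ∧
      sandwich
          (P.regroup l hl : ((∀ i, H i) × P.ExtSpace l) →L[ℂ] (∀ i, Fin (P.d i) → H i))
          (opSum (P.eval z) (P.extW l z))
          ((P.regroup l hl).symm :
            (∀ i, Fin (P.d i) → H i) →L[ℂ] ((∀ i, H i) × P.ExtSpace l)) =
        sandwich (E : (∀ i, Fin (P.d i) → H i) →L[ℂ] (∀ i, Fin (P.d i) → H i))
          (subScalar P.companion z)
          (F : (∀ i, Fin (P.d i) → H i) →L[ℂ] (∀ i, Fin (P.d i) → H i)) := by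
  obtain ⟨C, hC⟩ := P.exists_isExtension
  have hlead : ∀ i, IsGivenBy (P.lead i) (fun x => x ∈ (P.lead i).domain) (C i i (P.d i)) :=
    fun i => hC i i _
  -- Since `d i ≠ l i`, the leading coefficients are everywhere defined, so their extensions are
  -- themselves bijective.
  have hleadb : ∀ i x, x ∈ (P.lead i).domain := fun i =>
    (hbdd i i (P.d i) (hl i).ne').mem_domain
  have hCinv : ∀ i y, C i i (P.d i) (inv (P.lead i) y) = y := fun i y =>
    ((hlead i).apply_inv (hinv i) y).2
  have hCbij : ∀ i, Function.Bijective (C i i (P.d i)) := fun i =>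
    Function.bijective_iff_has_inverse.2 ⟨inv (P.lead i), fun x =>
      (hlead i).inv_apply (hinv i) (hleadb i x), hCinv i⟩
  obtain ⟨E, hE, hEf⟩ := (isBoundedOp_matE hl hbdd z).exists_equiv
    (isGivenBy_matE hC hl hdeg hbdd z) (matE_bijective hC hl hdeg hCbij z)
  obtain ⟨F, hF, hFf⟩ := (P.isBoundedOp_matF l z).exists_equiv
    (P.isGivenBy_matF hl z) (matF_bijective hl hz)
  refine ⟨E, F, hE, hF, ?_⟩
  have hFz : ∀ x i r, r < P.d i → zeroExt (F x i) r = colF (P.d i) (l i) z (zeroExt (x i)) r := by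
    intro x i r hr
    rw [zeroExt_of_lt _ hr, hFf]
  refine (((isGivenBy_eval hC hdeg hbdd z).opSum
    (P.isGivenBy_extW (fun i => (hl i).le) z)).sandwich _ _).eq_of
    (((isGivenBy_companion hC hl hbdd).subScalar z).sandwich _ _) (fun x => ?_) fun x _ => ?_
  · simp only [ContinuousLinearEquiv.coe_coe, and_true, regroup_symm_fst]
    refine forall_congr' fun i => ?_
    have hi := hl i
    -- The domain of `T` constrains only the pivot component of `F x`, a nonzero multiple of the
    -- component on which `P(z)` acts.
    rw [hFz _ _ _ (by omega), colF_pivot hi, P.smul_mem_colDomain_iff]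
    rcases hz i with h | h
    · simp [h]
    · exact pow_ne_zero _ h
  · simp only [ContinuousLinearEquiv.coe_coe, regroup_symm_fst]
    set v : ∀ i, Fin (P.d i) → H i := fun j r => (if (r : ℕ) = 0 then
      -inv (P.lead j) (∑ i, ∑ c ∈ Finset.range (P.d i),
        C j i (P.d i - 1 - c) (zeroExt (F x i) c)) else zeroExt (F x j) (r - 1)) with hv
    have hv0 : ∀ j, C j j (P.d j) (zeroExt ((v - z • F x) j) 0) =
        -∑ i, (∑ c ∈ Finset.range (P.d i),
          C j i (P.d i - 1 - c) (colF (P.d i) (l i) z (zeroExt (x i)) c) +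
          z • C j i (P.d i) (colF (P.d i) (l i) z (zeroExt (x i)) 0)) := by
      intro j
      have hd : ∀ i, 0 < P.d i := fun i => (Nat.zero_le _).trans_lt (hl i)
      rw [zeroExt_of_lt _ (hd j), Pi.sub_apply, Pi.sub_apply, Pi.smul_apply, Pi.smul_apply,
        ← zeroExt_of_lt (F x j) (hd j), map_sub, map_smul, hFz x j 0 (hd j)]
      simp only [hv, if_true]
      rw [map_neg, hCinv, Finset.sum_add_distrib, neg_add, sub_eq_add_neg]
      congr 2
      · exact Finset.sum_congr rfl fun i _ => Finset.sum_congr rfl fun c hc => by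
          rw [hFz _ _ _ (Finset.mem_range.1 hc)]
      · symm
        refine Finset.sum_eq_single_of_mem j (Finset.mem_univ j) fun i _ hij => ?_
        rw [hC.eq_zero (hdeg j i hij.symm), LinearMap.zero_apply, smul_zero]
    have hvs : ∀ j r, 1 ≤ r → r < P.d j → zeroExt ((v - z • F x) j) r =
        colF (P.d j) (l j) z (zeroExt (x j)) (r - 1) -
          z • colF (P.d j) (l j) z (zeroExt (x j)) r := by
      intro j r hr hrd
      rw [zeroExt_of_lt _ hrd, Pi.sub_apply, Pi.sub_apply, Pi.smul_apply, Pi.smul_apply,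
        ← zeroExt_of_lt (F x j) hrd, hFz x j r hrd]
      simp only [hv, show r ≠ 0 by omega, if_false]
      rw [hFz x j (r - 1) (by omega)]
    funext j r
    rw [regroup_apply, hEf]
    by_cases hr : (r : ℕ) = 0
    · simp only [hr, if_true]
      have hsplit : ∀ i ∈ Finset.univ, ∑ c ∈ Finset.range (P.d i),
          firstRow (C j i) (P.d i) (l i) z c (zeroExt ((v - z • F x) i) c) =
          ∑ c ∈ Finset.range (P.d i - 1), firstRow (C j i) (P.d i) (l i) z (c + 1)
            (colF (P.d i) (l i) z (zeroExt (x i)) c -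
              z • colF (P.d i) (l i) z (zeroExt (x i)) (c + 1)) -
          C j i (P.d i) (zeroExt ((v - z • F x) i) 0) := by
        intro i _
        have hi := hl i
        have h := firstRow_zero (C j i) hi z
        rw [show Finset.range (P.d i) = Finset.range (P.d i - 1 + 1) by
            rw [Nat.sub_add_cancel]; omega,
          Finset.sum_range_succ', h, LinearMap.neg_apply, ← sub_eq_add_neg]
        congr 1
        refine Finset.sum_congr rfl fun c hc => ?_
        rw [hvs i (c + 1) (by omega) (by rw [Finset.mem_range] at hc; omega), Nat.add_sub_cancel]
      have hdiag : ∑ i, C j i (P.d i) (zeroExt ((v - z • F x) i) 0) =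
          C j j (P.d j) (zeroExt ((v - z • F x) j) 0) :=
        Finset.sum_eq_single_of_mem j (Finset.mem_univ j) fun i _ hij => by
          rw [hC.eq_zero (hdeg j i hij.symm), LinearMap.zero_apply]
      rw [Finset.sum_congr rfl hsplit, Finset.sum_sub_distrib, hdiag, hv0,
        sub_neg_eq_add, ← Finset.sum_add_distrib]
      refine Finset.sum_congr rfl fun i _ => ?_
      rw [← sum_firstRow_colF (C j i) (hl i) (hz i)]
      exact add_comm _ _
    · simp only [hr, if_false]
      have h1 : 1 ≤ (r : ℕ) := Nat.one_le_iff_ne_zero.2 hr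
      have hrd := r.2
      have hj := hl j
      rw [rowE_colF (hl j) z (zeroExt (x j)) _ (hvs j) h1 hrd, zeroExt_of_lt _ (by omega)]
      simp only
      congr 1
      funext s
      exact P.regroup_symm_snd hl x j s

theorem opEquiv_companion [∀ i, CompleteSpace (H i)]
    (hdeg : ∀ j i, j ≠ i → P.deg j i < P.d i) (hinv : ∀ i, Invertible (P.lead i))
    (hbdd : ∀ j i k, k ≠ l i → IsBoundedOp (P.coeff j i k)) (hl : ∀ i, l i < P.d i)
    {z : ℂ} (hz : ∀ i, l i = 0 ∨ z ≠ 0) :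
    OpEquiv (opSum (P.eval z) (P.extW l z)) (subScalar P.companion z) := by
  obtain ⟨E, F, -, -, h⟩ := exists_explicit_equivalence hdeg hinv hbdd hl hz
  exact OpEquiv.trans (OpEquiv.symm ⟨P.regroup l hl, (P.regroup l hl).symm, rfl⟩)
    ⟨E, F, h⟩

end OpMatrixPoly

/-! ### Splitting an operator off a direct sum -/

section Extraction

variable {X Λ : Type*} [NormedAddCommGroup X] [NormedSpace ℂ X]
  [NormedAddCommGroup Λ] [NormedSpace ℂ Λ]

/-- The isomorphism `(x, y) ↦ (D ρ x + G (x + e y), x + e y)`, where `ρ e = 1`. -/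
def extractionRight (e : Λ →L[ℂ] X) (ρ : X →L[ℂ] Λ) (hρ : ∀ y, ρ (e y) = y) (D : Λ ≃L[ℂ] Λ)
    (G : X →L[ℂ] Λ) : (X × Λ) ≃L[ℂ] (Λ × X) :=
  ContinuousLinearEquiv.equivOfInverse
    (((D : Λ →L[ℂ] Λ).comp (ρ.comp (ContinuousLinearMap.fst ℂ X Λ)) + G.comp (ContinuousLinearMap.fst ℂ X Λ + e.comp (ContinuousLinearMap.snd ℂ X Λ))).prod
      (ContinuousLinearMap.fst ℂ X Λ + e.comp (ContinuousLinearMap.snd ℂ X Λ)))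
    ((ContinuousLinearMap.snd ℂ Λ X - e.comp (ρ.comp (ContinuousLinearMap.snd ℂ Λ X) -
        (D.symm : Λ →L[ℂ] Λ).comp (ContinuousLinearMap.fst ℂ Λ X - G.comp (ContinuousLinearMap.snd ℂ Λ X)))).prod
      (ρ.comp (ContinuousLinearMap.snd ℂ Λ X) - (D.symm : Λ →L[ℂ] Λ).comp (ContinuousLinearMap.fst ℂ Λ X - G.comp (ContinuousLinearMap.snd ℂ Λ X))))
    (fun x => by ext <;> simp [hρ])
    (fun p => by ext <;> simp [hρ])

/-- The isomorphism `(a, b) ↦ (e a + b - e ρ b - B e w, w)` with `w = D⁻¹ (ρ b - A a)`, where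
`ρ e = 1`. -/
def extractionLeft (e : Λ →L[ℂ] X) (ρ : X →L[ℂ] Λ) (hρ : ∀ y, ρ (e y) = y) (D : Λ ≃L[ℂ] Λ)
    (A : Λ →L[ℂ] Λ) (B : X →L[ℂ] X) : (Λ × X) ≃L[ℂ] (X × Λ) :=
  ContinuousLinearEquiv.equivOfInverse
    ((e.comp (ContinuousLinearMap.fst ℂ Λ X) + ContinuousLinearMap.snd ℂ Λ X - e.comp (ρ.comp (ContinuousLinearMap.snd ℂ Λ X)) -
        B.comp (e.comp ((D.symm : Λ →L[ℂ] Λ).comp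
          (ρ.comp (ContinuousLinearMap.snd ℂ Λ X) - A.comp (ContinuousLinearMap.fst ℂ Λ X))))).prod
      ((D.symm : Λ →L[ℂ] Λ).comp (ρ.comp (ContinuousLinearMap.snd ℂ Λ X) - A.comp (ContinuousLinearMap.fst ℂ Λ X))))
    ((ρ.comp (ContinuousLinearMap.fst ℂ X Λ + B.comp (e.comp (ContinuousLinearMap.snd ℂ X Λ)))).prod
      (ContinuousLinearMap.fst ℂ X Λ + B.comp (e.comp (ContinuousLinearMap.snd ℂ X Λ)) -
        e.comp (ρ.comp (ContinuousLinearMap.fst ℂ X Λ + B.comp (e.comp (ContinuousLinearMap.snd ℂ X Λ)))) +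
        e.comp ((D : Λ →L[ℂ] Λ).comp (ContinuousLinearMap.snd ℂ X Λ) +
          A.comp (ρ.comp (ContinuousLinearMap.fst ℂ X Λ + B.comp (e.comp (ContinuousLinearMap.snd ℂ X Λ)))))))
    (fun x => by
      ext <;> simp [hρ]
      abel)
    (fun p => by
      ext <;> simp [hρ]
      abel)

theorem extractionRight_apply (e : Λ →L[ℂ] X) (ρ : X →L[ℂ] Λ) (hρ : ∀ y, ρ (e y) = y)
    (D : Λ ≃L[ℂ] Λ) (G : X →L[ℂ] Λ) (x : X × Λ) :
    extractionRight e ρ hρ D G x = (D (ρ x.1) + G (x.1 + e x.2), x.1 + e x.2) := rfl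

theorem extractionLeft_apply (e : Λ →L[ℂ] X) (ρ : X →L[ℂ] Λ) (hρ : ∀ y, ρ (e y) = y)
    (D : Λ ≃L[ℂ] Λ) (A : Λ →L[ℂ] Λ) (B : X →L[ℂ] X) (p : Λ × X) :
    extractionLeft e ρ hρ D A B p =
      (e p.1 + p.2 - e (ρ p.2) - B (e (D.symm (ρ p.2 - A p.1))), D.symm (ρ p.2 - A p.1)) := rfl

/-- `hw` recovers the auxiliary variable `y` from the two outputs, `R` serving as a left inverse of
`A` where it is applied. `hs` then rebuilds the value of `P` by replacing the selected rows of `Q`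
with the output of `A` and removing the contribution of `e y`. -/
theorem opEquiv_extraction {P Q : X →ₗ.[ℂ] X} {A : Λ →ₗ.[ℂ] Λ} {SP SQ : X → Prop}
    {SA : Λ → Prop} {fP fQ : X → X} {fA : Λ → Λ} (hP : IsGivenBy P SP fP)
    (hQ : IsGivenBy Q SQ fQ) (hA : IsGivenBy A SA fA) (e : Λ →L[ℂ] X) (ρ : X →L[ℂ] Λ)
    (hρ : ∀ y, ρ (e y) = y) (D : Λ ≃L[ℂ] Λ) (G : X →L[ℂ] Λ) (R : Λ →L[ℂ] Λ) (B : X →L[ℂ] X)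
    (hS : ∀ x y, SP x ↔ SA (D (ρ x) + G (x + e y)) ∧ SQ (x + e y))
    (hw : ∀ x y, SP x → ρ (fQ (x + e y)) - R (fA (D (ρ x) + G (x + e y))) = D y)
    (hs : ∀ x y, SP x → fP x = e (fA (D (ρ x) + G (x + e y))) + fQ (x + e y) -
      e (ρ (fQ (x + e y))) - B (e y)) :
    OpEquiv (opSum P (full (ContinuousLinearMap.id ℂ Λ))) (opSum A Q) := by
  refine OpEquiv.of_isGivenBy (hP.opSum (IsGivenBy.full _)) (hA.opSum hQ)
    (extractionLeft e ρ hρ D R B) (extractionRight e ρ hρ D G) (fun x => ?_) fun x hx => ?_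
  · rw [and_true]
    exact hS x.1 x.2
  · have hw' := hw x.1 x.2 hx.1
    have hs' := hs x.1 x.2 hx.1
    rw [extractionRight_apply, extractionLeft_apply]
    simp only
    rw [hw', D.symm_apply_apply, hs']
    rfl

end Extraction

/-! ### Normalization of the rows with `l j = d j` -/

namespace OpMatrixPoly

variable {n : ℕ} {H : Fin n → Type u}
  [∀ i, NormedAddCommGroup (H i)] [∀ i, NormedSpace ℂ (H i)]

/-- The polynomial in which the rows `j` with `l j = d j` are multiplied from the left by the
inverse of the leading coefficient. -/
abbrev rowNormalized (P : OpMatrixPoly H) (l : Fin n → ℕ) : OpMatrixPoly H where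
  deg := P.deg
  coeff j i k :=
    if l j = P.d j then
      if k < P.d i then P.hat j i k
      else if k = P.d i ∧ j = i then full (delta j i) else 0
    else P.coeff j i k
  coeff_eq_zero j i k hk := by
    split_ifs with h1 h2 h3
    · rw [hat, P.coeff_eq_zero j i k hk]
      exact ((IsGivenBy.zero.compPMap _).eq_of IsGivenBy.zero (by simp) (by simp))
    · obtain ⟨rfl, rfl⟩ := h3
      exact absurd hk (lt_irrefl _)
    · rfl
    · exact P.coeff_eq_zero j i k hk

/-- The numbers `l i`, with `d i` replaced by `0`. -/
def reducedIndex (P : OpMatrixPoly H) (l : Fin n → ℕ) (i : Fin n) : ℕ :=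
  if l i = P.d i then 0 else l i

theorem delta_self (i : Fin n) : (delta i i : H i →L[ℂ] H i) = ContinuousLinearMap.id ℂ (H i) :=
  ContinuousLinearMap.ext fun x => Pi.single_eq_same (M := H) i x

section RowNormalized

variable {P : OpMatrixPoly H} {l : Fin n → ℕ}

theorem reducedIndex_lt (hd : ∀ i, 0 < P.d i) (hl : ∀ i, l i ≤ P.d i) (i : Fin n) :
    P.reducedIndex l i < P.d i := by
  rw [reducedIndex]
  split_ifs with h
  · exact hd i
  · exact lt_of_le_of_ne (hl i) h

theorem isBoundedOp_hat {j i : Fin n} {k : ℕ} (h : IsBoundedOp (P.coeff j i k)) :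
    IsBoundedOp (P.hat j i k) :=
  h.compPMap (inv (P.lead j))

theorem isBoundedOp_rowNormalized (hdeg : ∀ j i, j ≠ i → P.deg j i < P.d i)
    (hbdd : ∀ j i k, k ≠ l i → IsBoundedOp (P.coeff j i k)) (j i : Fin n) (k : ℕ)
    (hk : l i = P.d i ∨ k ≠ l i) : IsBoundedOp ((P.rowNormalized l).coeff j i k) := by
  simp only
  split_ifs with h1 h2 h3
  · exact isBoundedOp_hat (hbdd j i k (by omega))
  · exact IsBoundedOp.full _
  · exact IsBoundedOp.zero
  -- In an unnormalized row, `k = l i` forces `l i = d i` and hence `j ≠ i`, where the degree bound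
  -- makes the coefficient vanish.
  · by_cases hkl : k = l i
    · have hli := hk.resolve_right (by simpa using hkl)
      have hji : j ≠ i := by
        rintro rfl
        exact h1 hli
      rw [P.coeff_eq_zero j i k (by rw [hkl, hli]; exact hdeg j i hji)]
      exact IsBoundedOp.zero
    · exact hbdd j i k hkl

theorem rowNormalized_lead_of_eq {j : Fin n} (h : l j = P.d j) :
    (P.rowNormalized l).lead j = full (ContinuousLinearMap.id ℂ (H j)) := by
  simp [lead, h, delta_self]

theorem rowNormalized_lead_of_ne {j : Fin n} (h : l j ≠ P.d j) :
    (P.rowNormalized l).lead j = P.lead j := by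
  simp [lead, h]

theorem invertible_full_id {X : Type*} [NormedAddCommGroup X] [NormedSpace ℂ X] :
    Invertible (full (ContinuousLinearMap.id ℂ X)) :=
  ⟨_, isBoundedInverse_full (.refl ℂ X)⟩

theorem invertible_rowNormalized_lead (hinv : ∀ i, Invertible (P.lead i)) (j : Fin n) :
    Invertible ((P.rowNormalized l).lead j) := by
  by_cases h : l j = P.d j
  · rw [rowNormalized_lead_of_eq h]
    exact invertible_full_id
  · rw [rowNormalized_lead_of_ne h]
    exact hinv j

/-- In a normalized row the new leading coefficient is the identity, so a second normalization has
no effect. Hence the companion operator is unchanged. -/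
theorem rowNormalized_hat (j i : Fin n) {k : ℕ} (hk : k < P.d i) :
    (P.rowNormalized l).hat j i k = P.hat j i k := by
  by_cases h : l j = P.d j
  · obtain ⟨f, hf⟩ := IsGivenBy.exists_linear (P.hat j i k)
    rw [hat, rowNormalized_lead_of_eq h]
    simp only [h, hk, if_true]
    refine (hf.compPMap _).eq_of hf (fun _ => Iff.rfl) fun x _ => ?_
    exact (IsGivenBy.full (ContinuousLinearMap.id ℂ (H j))).inv_apply invertible_full_id trivial
  · rw [hat, rowNormalized_lead_of_ne h, hat]
    simp only [h, if_false]

theorem rowNormalized_companion (hd : ∀ i, 0 < P.d i) :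
    (P.rowNormalized l).companion = P.companion := by
  refine congrArg opMatrix (funext fun j => funext fun i => congrArg opMatrix
    (funext fun r => funext fun c => ?_))
  rw [rowNormalized_hat j i (show P.d i - 1 - c < P.d i by have := hd i; omega)]

/-- A bounded closure is an everywhere defined continuous extension. Only this extension property is
used; the normalized polynomial keeps the original domains. -/
theorem exists_closure (hclos : ∀ i, l i = P.d i → ∀ j k, k < P.d j →
    ClosureIsBoundedOp (P.hat i j k)) :
    ∃ G : ∀ j i : Fin n, ℕ → H i →L[ℂ] H j, ∀ j i k, l j = P.d j → k < P.d i →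
      IsGivenBy (P.hat j i k) (fun x => x ∈ (P.hat j i k).domain) (G j i k) := by
  have h : ∀ j i k, ∃ G : H i →L[ℂ] H j, l j = P.d j → k < P.d i →
      IsGivenBy (P.hat j i k) (fun x => x ∈ (P.hat j i k).domain) G := by
    intro j i k
    by_cases hk : l j = P.d j ∧ k < P.d i
    · obtain ⟨G, hG⟩ := (hclos j hk.1 i k hk.2).2
      refine ⟨G, fun _ _ => ⟨fun _ => Iff.rfl, fun x hx => ?_⟩⟩
      have hle := (P.hat j i k).le_closure
      rw [hG] at hle
      exact hle.2 (y := ⟨x, Submodule.mem_top⟩) rfl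
    · exact ⟨0, fun h1 h2 => absurd ⟨h1, h2⟩ hk⟩
  choose G hG using h
  exact ⟨G, hG⟩

theorem exists_bounded_extension {C : ∀ j i : Fin n, ℕ → H i →ₗ[ℂ] H j} (hC : P.IsExtension C)
    (hbdd : ∀ j i k, k ≠ l i → IsBoundedOp (P.coeff j i k)) :
    ∃ B : ∀ j i : Fin n, ℕ → H i →L[ℂ] H j, ∀ j i k, k ≠ l i → ∀ x, B j i k x = C j i k x := by
  have h : ∀ j i k, ∃ B : H i →L[ℂ] H j, k ≠ l i → ∀ x, B x = C j i k x := by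
    intro j i k
    by_cases hk : k = l i
    · exact ⟨0, fun h => absurd hk h⟩
    · obtain ⟨B, -, hB⟩ := (hbdd j i k hk).exists_clm (hC j i k)
      exact ⟨B, fun _ => hB⟩
  choose B hB using h
  exact ⟨B, hB⟩

/-- Extensions of the coefficients of the row-normalized polynomial. -/
theorem isExtension_rowNormalized {C : ∀ j i : Fin n, ℕ → H i →ₗ[ℂ] H j} (hC : P.IsExtension C)
    {G : ∀ j i : Fin n, ℕ → H i →L[ℂ] H j} (hG : ∀ j i k, l j = P.d j → k < P.d i →
      IsGivenBy (P.hat j i k) (fun x => x ∈ (P.hat j i k).domain) (G j i k)) :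
    (P.rowNormalized l).IsExtension fun j i k =>
      if l j = P.d j then
        if k < P.d i then (G j i k : H i →ₗ[ℂ] H j)
        else if k = P.d i ∧ j = i then (delta j i : H i →L[ℂ] H j) else 0
      else C j i k := by
  intro j i k
  simp only
  split_ifs with h1 h2 h3
  · exact hG j i k h1 h2
  · exact (IsGivenBy.full _).congr (fun x => iff_of_true trivial Submodule.mem_top) fun _ _ => rfl
  · exact IsGivenBy.zero.congr (fun x => iff_of_true trivial Submodule.mem_top) fun _ _ => rfl
  · exact hC j i k

theorem colDomain_rowNormalized_iff (hl : ∀ i, l i ≤ P.d i)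
    (hdeg : ∀ j i, j ≠ i → P.deg j i < P.d i)
    (hbdd : ∀ j i k, k ≠ l i → IsBoundedOp (P.coeff j i k)) (i : Fin n) (x : H i) :
    (P.rowNormalized l).colDomain (P.reducedIndex l) i x ↔
      (l i ≠ P.d i → P.colDomain l i x) := by
  by_cases h : l i = P.d i
  · exact iff_of_true (fun j => (isBoundedOp_rowNormalized hdeg hbdd j i _ (Or.inl h)).mem_domain x)
      fun h' => absurd h h'
  · rw [forall_prop_of_true h]
    refine forall_congr' fun j => ?_
    have hlt : l i < P.d i := lt_of_le_of_ne (hl i) h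
    simp only [reducedIndex, h, if_false, hlt, if_true]
    split_ifs
    · rfl
    · rfl

theorem colDomain_of_eq {i : Fin n} (h : l i = P.d i)
    (hdeg : ∀ j i, j ≠ i → P.deg j i < P.d i) (x : H i) :
    P.colDomain l i x ↔ x ∈ (P.lead i).domain := by
  refine ⟨fun hx => ?_, fun hx j => ?_⟩
  · have := hx i
    rwa [h] at this
  · by_cases hji : j = i
    · subst hji
      rw [h]
      exact hx
    · rw [h, P.coeff_eq_zero j i _ (hdeg j i hji)]
      exact Submodule.mem_top

end RowNormalized

end OpMatrixPoly

/-! ### Splitting off the leading coefficients with `l i = d i` -/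

namespace OpMatrixPoly

variable {n : ℕ} {H : Fin n → Type u}
  [∀ i, NormedAddCommGroup (H i)] [∀ i, NormedSpace ℂ (H i)]
  (P : OpMatrixPoly H) (l : Fin n → ℕ)

/-- The sum of the spaces `H i` over the indices with `l i = d i`. -/
abbrev TopSpace : Type u := ∀ i : {i : Fin n // l i = P.d i}, H i

/-- The embedding of the sum of the spaces with `l i = d i`. -/
def topIncl : P.TopSpace l →L[ℂ] (∀ i, H i) :=
  ContinuousLinearMap.pi fun i =>
    if h : l i = P.d i then ContinuousLinearMap.proj (R := ℂ)
      (φ := fun i : {i : Fin n // l i = P.d i} => H i) ⟨i, h⟩ else 0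

/-- The projection onto the sum of the spaces with `l i = d i`. -/
def topProj : (∀ i, H i) →L[ℂ] P.TopSpace l :=
  ContinuousLinearMap.pi fun i => ContinuousLinearMap.proj (i : Fin n)

theorem topIncl_of_eq (y : P.TopSpace l) {i : Fin n} (h : l i = P.d i) :
    P.topIncl l y i = y ⟨i, h⟩ := by
  simp [topIncl, h]

theorem topIncl_of_ne (y : P.TopSpace l) {i : Fin n} (h : l i ≠ P.d i) :
    P.topIncl l y i = 0 := by
  simp [topIncl, h]

theorem topProj_topIncl (y : P.TopSpace l) : P.topProj l (P.topIncl l y) = y :=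
  funext fun i => P.topIncl_of_eq l y i.2

/-- Multiplication of the `i`-th component by `z ^ d i`. -/
def topScale {z : ℂ} (hz : z ≠ 0) : P.TopSpace l ≃L[ℂ] P.TopSpace l :=
  ContinuousLinearEquiv.equivOfInverse
    (ContinuousLinearMap.pi fun i => z ^ P.d i • ContinuousLinearMap.proj i)
    (ContinuousLinearMap.pi fun i => (z ^ P.d i)⁻¹ • ContinuousLinearMap.proj i)
    (fun x => funext fun i => inv_smul_smul₀ (pow_ne_zero _ hz) (x i))
    (fun x => funext fun i => smul_inv_smul₀ (pow_ne_zero _ hz) (x i))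

theorem topScale_apply {z : ℂ} (hz : z ≠ 0) (x : P.TopSpace l)
    (i : {i : Fin n // l i = P.d i}) : P.topScale l hz x i = z ^ P.d i • x i := rfl

/-- The bounded operator matrix with entries `∑ k < d i, z ^ k • A j i k`. -/
def lowerPart (A : ∀ j i : Fin n, ℕ → H i →L[ℂ] H j) (z : ℂ) : (∀ i, H i) →L[ℂ] (∀ i, H i) :=
  ContinuousLinearMap.pi fun j => ∑ i, ∑ k ∈ Finset.range (P.d i),
    z ^ k • (A j i k).comp (ContinuousLinearMap.proj i)

theorem lowerPart_apply (A : ∀ j i : Fin n, ℕ → H i →L[ℂ] H j) (z : ℂ) (x : ∀ i, H i)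
    (j : Fin n) : P.lowerPart A z x j = ∑ i, ∑ k ∈ Finset.range (P.d i), z ^ k • A j i k (x i) := by
  simp [lowerPart]

variable {P l}

theorem sum_eval_eq {C : ∀ j i : Fin n, ℕ → H i →ₗ[ℂ] H j} (hC : P.IsExtension C)
    (hdeg : ∀ j i, j ≠ i → P.deg j i < P.d i) (z : ℂ) (x : ∀ i, H i) (j : Fin n) :
    ∑ i, ∑ k ∈ Finset.range (P.d i + 1), z ^ k • C j i k (x i) =
      ∑ i, ∑ k ∈ Finset.range (P.d i), z ^ k • C j i k (x i) +
        z ^ P.d j • C j j (P.d j) (x j) := by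
  simp only [Finset.sum_range_succ, Finset.sum_add_distrib]
  congr 1
  refine Finset.sum_eq_single_of_mem j (Finset.mem_univ j) fun i _ hij => ?_
  rw [hC.eq_zero (hdeg j i hij.symm), LinearMap.zero_apply, smul_zero]

/-- The leading coefficients with `l i = d i` can be split off the polynomial. -/
theorem opEquiv_leadSum_rowNormalized (hdeg : ∀ j i, j ≠ i → P.deg j i < P.d i)
    (hinv : ∀ i, Invertible (P.lead i)) (hl : ∀ i, l i ≤ P.d i)
    (hbdd : ∀ j i k, k ≠ l i → IsBoundedOp (P.coeff j i k))
    (hclos : ∀ i, l i = P.d i → ∀ j k, k < P.d j → ClosureIsBoundedOp (P.hat i j k))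
    {z : ℂ} (hz : z ≠ 0) :
    OpEquiv (opSum (P.eval z) (full (ContinuousLinearMap.id ℂ (P.TopSpace l))))
      (opSum (P.leadSum l) ((P.rowNormalized l).eval z)) := by
  obtain ⟨C, hC⟩ := P.exists_isExtension
  obtain ⟨B, hB⟩ := exists_bounded_extension hC hbdd
  obtain ⟨G, hG⟩ := exists_closure hclos
  have hlead : ∀ i, IsGivenBy (P.lead i) (fun x => x ∈ (P.lead i).domain) (C i i (P.d i)) :=
    fun i => hC i i _
  have hC' := isExtension_rowNormalized hC hG
  -- On the domain of the coefficient, `G` is the inverse leading coefficient applied to it; its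
  -- value therefore lies in the domain of that leading coefficient, which undoes the normalization.
  have hGC : ∀ j i k, l j = P.d j → k < P.d i → ∀ x, x ∈ (P.coeff j i k).domain →
      G j i k x ∈ (P.lead j).domain ∧ C j j (P.d j) (G j i k x) = C j i k x := by
    intro j i k hj hk x hx
    have h : G j i k x = inv (P.lead j) (C j i k x) := by
      rw [← (hG j i k hj hk).apply_eq x hx]
      exact congrArg (inv (P.lead j)) ((hC j i k).apply_eq x hx)
    rw [h]
    exact (hlead j).apply_inv (hinv j) _
  have hQdeg : ∀ j i, j ≠ i → (P.rowNormalized l).deg j i < (P.rowNormalized l).d i := hdeg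
  have hQ := isGivenBy_eval (l := P.reducedIndex l) hC' hQdeg (fun j i k hk =>
    isBoundedOp_rowNormalized hdeg hbdd j i k (by
      by_cases h : l i = P.d i
      · exact Or.inl h
      · rw [reducedIndex, if_neg h] at hk
        exact Or.inr hk)) z
  -- Adding `y` affects only columns with `l i = d i`, where all coefficients of index below `d i`
  -- are everywhere defined.
  have hcd : ∀ (x : ∀ i, H i) (y : P.TopSpace l),
      (∀ i, l i ≠ P.d i → P.colDomain l i (x i)) → ∀ j i k, k < P.d i →
      (x + P.topIncl l y) i ∈ (P.coeff j i k).domain := by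
    intro x y hx j i k hk
    by_cases hi : l i = P.d i
    · exact (hbdd j i k (by omega)).mem_domain _
    · rw [Pi.add_apply, P.topIncl_of_ne l y hi, add_zero]
      exact mem_domain_of_colDomain hbdd (hx i hi) j k
  have hp : ∀ (x : ∀ i, H i) (y : P.TopSpace l) (j : {j : Fin n // l j = P.d j}),
      (P.topScale l hz (P.topProj l x) +
        (P.topProj l).comp (P.lowerPart G z) (x + P.topIncl l y)) j =
      z ^ P.d j • x j + ∑ i, ∑ k ∈ Finset.range (P.d i),
        z ^ k • G j i k ((x + P.topIncl l y) i) := by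
    intro x y j
    rw [← P.lowerPart_apply]
    rfl
  have hpdom : ∀ (x : ∀ i, H i) (y : P.TopSpace l),
      (∀ i, l i ≠ P.d i → P.colDomain l i (x i)) → ∀ j, l j = P.d j →
      ∑ i, ∑ k ∈ Finset.range (P.d i), z ^ k • G j i k ((x + P.topIncl l y) i) ∈
        (P.lead j).domain := by
    intro x y hx j hj
    refine Submodule.sum_mem _ fun i _ => Submodule.sum_mem _ fun k hk =>
      Submodule.smul_mem _ _ ?_
    exact (hGC j i k hj (Finset.mem_range.1 hk) _ (hcd x y hx j i k (Finset.mem_range.1 hk))).1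
  have hCp : ∀ (x : ∀ i, H i) (y : P.TopSpace l),
      (∀ i, l i ≠ P.d i → P.colDomain l i (x i)) → ∀ j, l j = P.d j →
      C j j (P.d j) (∑ i, ∑ k ∈ Finset.range (P.d i),
        z ^ k • G j i k ((x + P.topIncl l y) i)) =
      ∑ i, ∑ k ∈ Finset.range (P.d i), z ^ k • C j i k ((x + P.topIncl l y) i) := by
    intro x y hx j hj
    simp only [map_sum, map_smul]
    refine Finset.sum_congr rfl fun i _ => Finset.sum_congr rfl fun k hk => ?_
    rw [(hGC j i k hj (Finset.mem_range.1 hk) _ (hcd x y hx j i k (Finset.mem_range.1 hk))).2]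
  have hBy : ∀ (y : P.TopSpace l) j, P.lowerPart B z (P.topIncl l y) j =
      ∑ i, ∑ k ∈ Finset.range (P.d i), z ^ k • C j i k (P.topIncl l y i) := by
    intro y j
    rw [P.lowerPart_apply]
    refine Finset.sum_congr rfl fun i _ => Finset.sum_congr rfl fun k hk => ?_
    by_cases hi : l i = P.d i
    · rw [hB j i k (by rw [Finset.mem_range] at hk; omega)]
    · rw [P.topIncl_of_ne l y hi, map_zero, map_zero]
  have hQtop : ∀ (q : ∀ i, H i) j, l j = P.d j →
      ∑ i, ∑ k ∈ Finset.range (P.d i + 1), z ^ k • (if l j = P.d j then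
        if k < P.d i then (G j i k : H i →ₗ[ℂ] H j)
        else if k = P.d i ∧ j = i then (delta j i : H i →L[ℂ] H j) else 0
        else C j i k) (q i) =
      z ^ P.d j • q j + ∑ i, ∑ k ∈ Finset.range (P.d i), z ^ k • G j i k (q i) := by
    intro q j hj
    rw [sum_eval_eq hC' hQdeg z q j, add_comm]
    congr 1
    · simp [hj, delta_self]
    · refine Finset.sum_congr rfl fun i _ => Finset.sum_congr rfl fun k hk => ?_
      simp [hj, Finset.mem_range.1 hk]
  refine opEquiv_extraction (isGivenBy_eval hC hdeg hbdd z) hQ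
    (IsGivenBy.opDiag fun i : {i : Fin n // l i = P.d i} => hlead i) (P.topIncl l) (P.topProj l)
    (P.topProj_topIncl l) (P.topScale l hz) ((P.topProj l).comp (P.lowerPart G z))
    (ContinuousLinearMap.pi fun i => (inv (P.lead i)).comp (ContinuousLinearMap.proj i))
    (P.lowerPart B z) (fun x y => ?_) (fun x y hx => ?_) (fun x y hx => ?_)
  · simp only [colDomain_rowNormalized_iff hl hdeg hbdd, hp]
    have hne : (∀ i, l i ≠ P.d i → P.colDomain l i ((x + P.topIncl l y) i)) ↔
        ∀ i, l i ≠ P.d i → P.colDomain l i (x i) :=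
      forall_congr' fun i => forall_congr' fun hi => by
        rw [Pi.add_apply, P.topIncl_of_ne l y hi, add_zero]
    rw [hne]
    constructor
    · intro hx
      refine ⟨fun j => Submodule.add_mem _ (Submodule.smul_mem _ _ ?_)
        (hpdom x y (fun i _ => hx i) j j.2), fun i _ => hx i⟩
      exact (colDomain_of_eq j.2 hdeg _).1 (hx j)
    -- The sum of the lower terms already lies in the domain of the leading coefficient, so it can
    -- be subtracted, and `z ≠ 0` removes the scaling.
    · rintro ⟨h1, h2⟩ i
      by_cases hi : l i = P.d i
      · rw [colDomain_of_eq hi hdeg, ← Submodule.smul_mem_iff _ (pow_ne_zero (P.d i) hz)]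
        exact (Submodule.add_mem_iff_left _ (hpdom x y h2 i hi)).1 (h1 ⟨i, hi⟩)
      · exact h2 i hi
  · funext j
    rw [Pi.sub_apply, P.topScale_apply]
    simp only [ContinuousLinearMap.pi_apply, ContinuousLinearMap.comp_apply,
      ContinuousLinearMap.proj_apply]
    rw [(hlead j).inv_apply (hinv j), ← ContinuousLinearMap.comp_apply, hp]
    -- Both terms contain the same sum of lower coefficients at `x + e y`; what remains is `z ^ d j`
    -- times `y`.
    · refine (congrArg (· - _) (hQtop _ j j.2)).trans ?_
      rw [add_sub_add_right_eq_sub, ← smul_sub, Pi.add_apply, add_sub_cancel_left,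
        P.topIncl_of_eq l y j.2]
    · rw [← ContinuousLinearMap.comp_apply, hp]
      exact Submodule.add_mem _ (Submodule.smul_mem _ _ ((colDomain_of_eq j.2 hdeg _).1 (hx j)))
        (hpdom x y (fun i _ => hx i) j j.2)
  · funext j
    rw [Pi.sub_apply, Pi.sub_apply, Pi.add_apply, hBy, sum_eval_eq hC hdeg]
    by_cases hj : l j = P.d j
    · rw [P.topIncl_of_eq l _ hj, P.topIncl_of_eq l _ hj]
      simp only [hp]
      rw [map_add, map_smul, hCp x y (fun i _ => hx i) j hj]
      simp only [Pi.add_apply, map_add, smul_add, Finset.sum_add_distrib]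
      simp only [topProj, ContinuousLinearMap.pi_apply, ContinuousLinearMap.proj_apply]
      abel
    · rw [P.topIncl_of_ne l _ hj, P.topIncl_of_ne l _ hj, zero_add, sub_zero]
      simp only [hj, if_false]
      rw [sum_eval_eq hC hdeg]
      simp only [Pi.add_apply, map_add, smul_add, Finset.sum_add_distrib,
        P.topIncl_of_ne l y hj, add_zero]
      abel

/-- Separation of the last components of the blocks with `l i = d i`. -/
theorem exists_extSpace_equiv [∀ i, CompleteSpace (H i)] (hd : ∀ i, 0 < P.d i) :
    Nonempty (P.ExtSpace l ≃L[ℂ]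
      P.TopSpace l × (P.rowNormalized l).ExtSpace (P.reducedIndex l)) := by
  have hlt : ∀ i, max (P.d i - 1) (P.reducedIndex l i) ≤ max (P.d i - 1) (l i) := by
    intro i
    rw [reducedIndex]
    split_ifs <;> omega
  have htop : ∀ i, l i = P.d i → P.d i - 1 < max (P.d i - 1) (l i) := by
    intro i hi
    have := hd i
    omega
  let A : P.ExtSpace l →L[ℂ] P.TopSpace l × (P.rowNormalized l).ExtSpace (P.reducedIndex l) :=
    (ContinuousLinearMap.pi fun i : {i : Fin n // l i = P.d i} => (ContinuousLinearMap.proj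
        (R := ℂ) (φ := fun _ : Fin (max (P.d i - 1) (l i)) => H i) ⟨P.d i - 1, htop i i.2⟩).comp
        (ContinuousLinearMap.proj (i : Fin n))).prod
      (ContinuousLinearMap.pi fun i => ContinuousLinearMap.pi
        fun s : Fin (max (P.d i - 1) (P.reducedIndex l i)) => (ContinuousLinearMap.proj
        (R := ℂ) (φ := fun _ : Fin (max (P.d i - 1) (l i)) => H i)
        ⟨s, s.2.trans_le (hlt i)⟩).comp (ContinuousLinearMap.proj i))
  have hA1 : ∀ x (i : {i : Fin n // l i = P.d i}),
      (A x).1 i = x i ⟨P.d i - 1, htop i i.2⟩ := fun _ _ => rfl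
  have hA2 : ∀ x i (s : Fin (max (P.d i - 1) (P.reducedIndex l i))),
      (A x).2 i s = x i ⟨s, s.2.trans_le (hlt i)⟩ := fun _ _ _ => rfl
  -- The only components lost by reducing `l` are the last ones, of index `d i - 1`, in the blocks
  -- with `l i = d i`.
  have hcase : ∀ i (s : ℕ), s < max (P.d i - 1) (l i) →
      ¬ s < max (P.d i - 1) (P.reducedIndex l i) → l i = P.d i ∧ s = P.d i - 1 := by
    intro i s hs hs'
    have := hd i
    rw [reducedIndex] at hs'
    split_ifs at hs' with h
    · omega
    · exact absurd hs hs'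
  refine ⟨ContinuousLinearEquiv.ofBijective A (LinearMap.ker_eq_bot.2 fun x y hxy => ?_)
    (LinearMap.range_eq_top.2 fun p => ?_)⟩
  · replace hxy : A x = A y := hxy
    funext i s
    by_cases hs : (s : ℕ) < max (P.d i - 1) (P.reducedIndex l i)
    · have := hA2 x i ⟨s, hs⟩
      rw [hxy, hA2] at this
      exact this.symm
    · obtain ⟨hi, hs⟩ := hcase i s s.2 hs
      have := hA1 x ⟨i, hi⟩
      rw [hxy, hA1] at this
      rw [show s = ⟨P.d i - 1, htop i hi⟩ from Fin.ext hs]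
      exact this.symm
  · refine ⟨fun i s => if h : (s : ℕ) < max (P.d i - 1) (P.reducedIndex l i) then p.2 i ⟨s, h⟩
      else if h : l i = P.d i then p.1 ⟨i, h⟩ else 0, Prod.ext (funext fun i => ?_)
      (funext fun i => funext fun s => ?_)⟩
    · refine (hA1 _ i).trans ?_
      have hi : P.reducedIndex l i = 0 := if_pos i.2
      rw [dif_neg (by simp only [hi]; omega), dif_pos i.2]
    · refine (hA2 _ i s).trans ?_
      exact dif_pos s.2

theorem opEquiv_extW [∀ i, CompleteSpace (H i)] (hl : ∀ i, l i ≤ P.d i) {z : ℂ}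
    (hz : ∀ i, l i = 0 ∨ z ≠ 0) :
    OpEquiv (P.extW l z) (full (ContinuousLinearMap.id ℂ (P.ExtSpace l))) := by
  obtain ⟨E, hE, -⟩ := (P.isBoundedOp_extW l z).exists_equiv (P.isGivenBy_extW hl z)
    (P.extW_bijective hz)
  rw [hE]
  exact OpEquiv.full_id E

theorem invertible_extW [∀ i, CompleteSpace (H i)] (hl : ∀ i, l i ≤ P.d i) {z : ℂ}
    (hz : ∀ i, l i = 0 ∨ z ≠ 0) : Invertible (P.extW l z) := by
  obtain ⟨E, hE, -⟩ := (P.isBoundedOp_extW l z).exists_equiv (P.isGivenBy_extW hl z)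
    (P.extW_bijective hz)
  rw [hE]
  exact ⟨_, isBoundedInverse_full E⟩

/-- `W` is exchanged for an identity on the selected spaces plus the `W` of the reduced indices. The
identity is spent on extracting the leading coefficients, and the reduced `W` on linearizing the
normalized polynomial. -/
theorem opEquiv_leadSum_companion [∀ i, CompleteSpace (H i)] (hd : ∀ i, 0 < P.d i)
    (hdeg : ∀ j i, j ≠ i → P.deg j i < P.d i)
    (hinv : ∀ i, Invertible (P.lead i)) (hl : ∀ i, l i ≤ P.d i)
    (hbdd : ∀ j i k, k ≠ l i → IsBoundedOp (P.coeff j i k))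
    (hclos : ∀ i, l i = P.d i → ∀ j k, k < P.d j → ClosureIsBoundedOp (P.hat i j k))
    {z : ℂ} (hz : z ≠ 0) :
    OpEquiv (opSum (P.eval z) (P.extW l z))
      (opSum (P.leadSum l) (subScalar P.companion z)) := by
  obtain ⟨e⟩ := exists_extSpace_equiv (P := P) (l := l) hd
  have hl' : ∀ i, P.reducedIndex l i < (P.rowNormalized l).d i := reducedIndex_lt hd hl
  have hidsum : full (ContinuousLinearMap.id ℂ
      (P.TopSpace l × (P.rowNormalized l).ExtSpace (P.reducedIndex l))) =
      opSum (full (ContinuousLinearMap.id ℂ (P.TopSpace l)))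
        (full (ContinuousLinearMap.id ℂ ((P.rowNormalized l).ExtSpace (P.reducedIndex l)))) :=
    (IsGivenBy.full _).eq_of ((IsGivenBy.full _).opSum (IsGivenBy.full _)) (by simp) (by simp)
  have hW : OpEquiv (P.extW l z) (opSum (full (ContinuousLinearMap.id ℂ (P.TopSpace l)))
      ((P.rowNormalized l).extW (P.reducedIndex l) z)) := by
    refine (opEquiv_extW hl fun _ => Or.inr hz).trans ((OpEquiv.id_of_equiv e).trans ?_)
    rw [hidsum]
    exact (OpEquiv.refl _).opSum (opEquiv_extW (fun i => (hl' i).le) fun _ => Or.inr hz).symm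
  have hQ : OpEquiv (opSum ((P.rowNormalized l).eval z)
      ((P.rowNormalized l).extW (P.reducedIndex l) z)) (subScalar P.companion z) := by
    have h := opEquiv_companion (P := P.rowNormalized l) (l := P.reducedIndex l) hdeg
      (invertible_rowNormalized_lead hinv) (fun j i k hk =>
        isBoundedOp_rowNormalized hdeg hbdd j i k (by
          by_cases h : l i = P.d i
          · exact Or.inl h
          · rw [reducedIndex, if_neg h] at hk
            exact Or.inr hk)) hl' (z := z) fun _ => Or.inr hz
    rwa [rowNormalized_companion hd] at h
  exact ((OpEquiv.refl _).opSum hW).trans <| (OpEquiv.opSum_assoc _ _ _).symm.trans <|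
    ((opEquiv_leadSum_rowNormalized hdeg hinv hl hbdd hclos hz).opSum (OpEquiv.refl _)).trans <|
    (OpEquiv.opSum_assoc _ _ _).trans <| (OpEquiv.refl _).opSum hQ

end OpMatrixPoly

end

end OpLin

/-! ### The theorem -/

theorem mainTheorem3 {n : ℕ} {H : Fin n → Type*}
    [∀ i, NormedAddCommGroup (H i)] [∀ i, NormedSpace ℂ (H i)] [∀ i, CompleteSpace (H i)]
    (P : OpLin.OpMatrixPoly H) (l : Fin n → ℕ)
    (hd : ∀ i, 0 < P.d i)
    (hdeg : ∀ j i, j ≠ i → P.deg j i < P.d i)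
    (hinv : ∀ i, OpLin.Invertible (P.lead i))
    (hl : ∀ i, l i ≤ P.d i)
    (hbdd : ∀ j i k, k ≠ l i → OpLin.IsBoundedOp (P.coeff j i k))
    (hclos : ∀ i, l i = P.d i → ∀ j k, k < P.d j → OpLin.ClosureIsBoundedOp (P.hat i j k)) :
    -- the extension `W` is invertible on `Ω`
    (∀ z ∈ OpLin.OpMatrixPoly.Omega l, OpLin.Invertible (P.extW l z)) ∧
    -- i)
    ((∀ i, l i ≠ P.d i) →
      OpLin.EquivalentOn (OpLin.OpMatrixPoly.Omega l)
        (fun z => OpLin.opSum (P.eval z) (P.extW l z))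
        (fun z => OpLin.subScalar P.companion z)) ∧
    -- ii)
    ((∃ i, l i = P.d i) →
      OpLin.Invertible (P.leadSum l) ∧
      OpLin.EquivalentOn (OpLin.OpMatrixPoly.Omega l)
        (fun z => OpLin.opSum (P.eval z) (P.extW l z))
        (fun z => OpLin.opSum (P.leadSum l) (OpLin.subScalar P.companion z))) ∧
    -- the explicit equivalence operators if `l i < d i` for all `i`
    (∀ hL : ∀ i, l i < P.d i, ∀ z ∈ OpLin.OpMatrixPoly.Omega l,
      ∃ E F : (∀ i, Fin (P.d i) → H i) ≃L[ℂ] (∀ i, Fin (P.d i) → H i),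
        P.matE l z = OpLin.full (E : (∀ i, Fin (P.d i) → H i) →L[ℂ] (∀ i, Fin (P.d i) → H i)) ∧
        P.matF l z = OpLin.full (F : (∀ i, Fin (P.d i) → H i) →L[ℂ] (∀ i, Fin (P.d i) → H i)) ∧
        OpLin.sandwich
            (P.regroup l hL :
              ((∀ i, H i) × P.ExtSpace l) →L[ℂ] (∀ i, Fin (P.d i) → H i))
            (OpLin.opSum (P.eval z) (P.extW l z))
            ((P.regroup l hL).symm :
              (∀ i, Fin (P.d i) → H i) →L[ℂ] ((∀ i, H i) × P.ExtSpace l)) =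
          OpLin.sandwich (E : (∀ i, Fin (P.d i) → H i) →L[ℂ] (∀ i, Fin (P.d i) → H i))
            (OpLin.subScalar P.companion z)
            (F : (∀ i, Fin (P.d i) → H i) →L[ℂ] (∀ i, Fin (P.d i) → H i))) := by

  have hz0 : ∀ z ∈ OpLin.OpMatrixPoly.Omega l, ∀ i, l i = 0 ∨ z ≠ 0 := fun z hz i =>
    hz.imp_left fun h => h i
  refine ⟨fun z hz => OpLin.OpMatrixPoly.invertible_extW hl (hz0 z hz), fun hne => ?_,
    fun ⟨i, hi⟩ => ⟨OpLin.invertible_opDiag fun i => hinv i, ?_⟩, fun hL z hz => ?_⟩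
  · exact OpLin.equivalentOn_of_opEquiv fun z hz => OpLin.OpMatrixPoly.opEquiv_companion hdeg hinv
      hbdd (fun i => lt_of_le_of_ne (hl i) (hne i)) (hz0 z hz)
  · refine OpLin.equivalentOn_of_opEquiv fun z hz =>
      OpLin.OpMatrixPoly.opEquiv_leadSum_companion hd hdeg hinv hl hbdd hclos ?_
    -- An index with `l i = d i > 0` excludes `0` from `Ω`.
    exact (hz0 z hz i).resolve_left (by rw [hi]; exact (hd i).ne')
  · exact OpLin.OpMatrixPoly.exists_explicit_equivalence hdeg hinv hbdd hL (hz0 z hz)
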